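/- Let $k$ be a field, let $Q$ be a finite quiver, and let $\Lambda=kQ/I$, where the ideal $I$ is generated by a set of paths of length two (a quadratic monomial algebra); assume that $\Lambda$ is finite-dimensional. Let $\Lambda^!=kQ^{\mathrm{op}}/I^!$ be its quadratic dual, where $I^!$ is generated by the paths $\alpha^{\mathrm{op}}\beta^{\mathrm{op}}$ of length two for which $\beta\alpha\notin I$. Grade $\Lambda^!$ by path length and regard it as a graded $k$-linear category whose objects are the vertices of $Q$. A graded $\Lambda^!$-module $M$ consists of $k$-vector spaces $M_i(x)$ ($i\in\mathbb Z$, $x\in Q_0$) together with a covariant $k$-linear action of $\Lambda^!$ under which $\Lambda^!(x,y)_n$ maps $M_i(x)$ to $M_{i+n}(y)$; morphisms are the degree-preserving morphisms of modules, and $M\langle i\rangle_n=M_{n-i}$. Let $P_x=\Lambda^!(x,-)$ be the indecomposable graded projectives and let $I_x$, with $(I_x)_{n}(y)=\operatorname{Hom}_k(\Lambda^!(y,x)_{-n},k)$, be the indecomposable graded injectives. Call a finite direct sum of modules $P_x\langle i\rangle$ (resp. $I_x\langle i\rangle$) a finite projective (resp. finite injective) module. A graded $\Lambda^!$-module $M$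 is - finitely presented if there is an exact sequence $P^{-1}\to P^0\to M\to 0$ with $P^{-1},P^0$ finite projective; - perfect if there is an exact sequence $0\to P^{-n}\to\cdots\to P^0\to M\to 0$ with all $P^{-i}$ finite projective; - finitely copresented if there is an exact sequence $0\to M\to I^0\to I^1$ with $I^0,I^1$ finite injective; - coperfect if there is an exact sequence $0\to M\to I^0\to\cdots\to I^n\to 0$ with all $I^i$ finite injective. Write $\Lambda^!\text{-Fp}^{\mathbb Z}$, $\Lambda^!\text{-Pe}^{\mathbb Z}$, $\Lambda^!\text{-Fcp}^{\mathbb Z}$, $\Lambda^!\text{-Cop}^{\mathbb Z}$ for the corresponding full subcategories of the category of graded $\Lambda^!$-modules, and $\Lambda^!\text{-gmod}$ for the full subcategory of graded modules of finite total dimension. Then $$\Lambda^!\text{-Pe}^{\mathbb Z}=\Lambda^!\text{-Fp}^{\mathbb Z},\qquad \Lambda^!\text{-Cop}^{\mathbb Z}=\Lambda^!\text{-Fcp}^{\mathbb Z},$$ and these are abelian categories. Moreover, $\Lambda^!\text{-gmod}$ is a Serre subcategory of both $\Lambda^!\text{-Fp}^{\mathbb Z}$ and $\Lambda^!\text{-Fcp}^{\mathbb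 Z}$, and the tails and cotails categories, that is, the Serre quotients $$\Lambda^!\text{-Fp}^{\mathbb Z}/\Lambda^!\text{-gmod}\qquad\text{and}\qquad\Lambda^!\text{-Fcp}^{\mathbb Z}/\Lambda^!\text{-gmod},$$ are abelian. -/

import Mathlib

universe u

open CategoryTheory Limits Opposite

namespace QuadMon

/-- A set of quadratic monomials (paths of length two) of a quiver: `R α β` means that the path
"first `α`, then `β`" belongs to the set. -/
abbrev QuadRel (V : Type u) [Quiver.{u} V] : Type u :=
  ∀ ⦃a b c : V⦄, (a ⟶ b) → (b ⟶ c) → Prop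

noncomputable section

variable (k : Type u) [Field k] {V : Type u} [Quiver.{u} V]

/-- The composition of the path category `kQ`, whose morphism space from `a` to `b` is the vector
space `Quiver.Path a b →₀ k` with basis the paths from `a` to `b`. -/
def pathMul (a b c : V) :
    (Quiver.Path a b →₀ k) →ₗ[k] (Quiver.Path b c →₀ k) →ₗ[k] (Quiver.Path a c →₀ k) :=
  Finsupp.linearCombination k fun p : Quiver.Path a b =>
    Finsupp.lmapDomain k k fun q : Quiver.Path b c => p.comp q

theorem pathMul_single {a b c : V} (p : Quiver.Path a b) (q : Quiver.Path b c) (r s : k) :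
    pathMul k a b c (Finsupp.single p r) (Finsupp.single q s)
      = Finsupp.single (p.comp q) (r * s) := by
  simp [pathMul, Finsupp.mapDomain_single]

/-- The component at `(a, b)` of the two-sided ideal `I` of `kQ` generated by the quadratic
monomials in `R`. -/
def ideal (R : QuadRel V) (a b : V) : Submodule k (Quiver.Path a b →₀ k) :=
  Submodule.span k {f | ∃ (c d e : V) (p : Quiver.Path a c) (α : c ⟶ d) (β : d ⟶ e)
    (q : Quiver.Path e b), R α β ∧ f = Finsupp.single (((p.cons α).cons β).comp q) 1}

theorem pathMul_mem_left (R : QuadRel V) {a b c : V} {f : Quiver.Path a b →₀ k}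
    (hf : f ∈ ideal k R a b) (g : Quiver.Path b c →₀ k) :
    pathMul k a b c f g ∈ ideal k R a c := by
  induction g using Finsupp.induction_linear with
  | zero => simp
  | add g₁ g₂ h₁ h₂ => rw [map_add]; exact add_mem h₁ h₂
  | single q s =>
    induction hf using Submodule.span_induction with
    | zero => simp
    | add x y _ _ hx hy => rw [map_add, LinearMap.add_apply]; exact add_mem hx hy
    | smul t x _ hx => rw [map_smul, LinearMap.smul_apply]; exact Submodule.smul_mem _ _ hx
    | mem x hx =>
      obtain ⟨c', d, e, p, α, β, q', hR, rfl⟩ := hx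
      rw [pathMul_single, one_mul, ← mul_one s, ← smul_eq_mul, ← Finsupp.smul_single]
      refine Submodule.smul_mem _ _ (Submodule.subset_span ⟨c', d, e, p, α, β, q'.comp q, hR, ?_⟩)
      rw [Quiver.Path.comp_assoc]

theorem pathMul_mem_right (R : QuadRel V) {a b c : V} (f : Quiver.Path a b →₀ k)
    {g : Quiver.Path b c →₀ k} (hg : g ∈ ideal k R b c) :
    pathMul k a b c f g ∈ ideal k R a c := by
  induction f using Finsupp.induction_linear with
  | zero => simp
  | add g₁ g₂ h₁ h₂ => rw [map_add, LinearMap.add_apply]; exact add_mem h₁ h₂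
  | single q s =>
    induction hg using Submodule.span_induction with
    | zero => simp
    | add x y _ _ hx hy => rw [map_add]; exact add_mem hx hy
    | smul t x _ hx => rw [map_smul]; exact Submodule.smul_mem _ _ hx
    | mem x hx =>
      obtain ⟨c', d, e, p, α, β, q', hR, rfl⟩ := hx
      rw [pathMul_single, ← smul_eq_mul, ← Finsupp.smul_single]
      refine Submodule.smul_mem _ _ (Submodule.subset_span ⟨c', d, e, q.comp p, α, β, q', hR, ?_⟩)
      rw [← Quiver.Path.comp_assoc]
      rfl

/-- The morphism space `Λ(a, b)` of the quadratic monomial algebra `Λ = kQ/I`, regarded as a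
`k`-linear category with the vertices of `Q` as objects. -/
abbrev Lam (R : QuadRel V) (a b : V) : Type u :=
  (Quiver.Path a b →₀ k) ⧸ ideal k R a b

/-- The class in `Λ(a, b)` of a path. -/
def Lam.ofPath (R : QuadRel V) {a b : V} (p : Quiver.Path a b) : Lam k R a b :=
  (ideal k R a b).mkQ (Finsupp.single p 1)

/-- The composition of `Λ`. -/
def Lam.mul (R : QuadRel V) (a b c : V) : Lam k R a b →ₗ[k] Lam k R b c →ₗ[k] Lam k R a c :=
  (ideal k R a b).liftQ
    ((ideal k R b c).liftQ ((pathMul k a b c).compr₂ (ideal k R a c).mkQ).flip (by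
      intro g hg
      ext f
      simpa using pathMul_mem_right k R (Finsupp.single f 1) hg)).flip (by
    intro f hf
    refine LinearMap.mem_ker.2 (Submodule.linearMap_qext _ (LinearMap.ext fun g => ?_))
    exact (Submodule.Quotient.mk_eq_zero _).2 (pathMul_mem_left k R hf g))

theorem Lam.mul_mk (R : QuadRel V) {a b c : V} (f : Quiver.Path a b →₀ k)
    (g : Quiver.Path b c →₀ k) :
    Lam.mul k R a b c ((ideal k R a b).mkQ f) ((ideal k R b c).mkQ g)
      = (ideal k R a c).mkQ (pathMul k a b c f g) := rfl

theorem Lam.mul_ofPath (R : QuadRel V) {a b c : V} (p : Quiver.Path a b) (q : Quiver.Path b c) :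
    Lam.mul k R a b c (Lam.ofPath k R p) (Lam.ofPath k R q) = Lam.ofPath k R (p.comp q) := by
  simp only [Lam.ofPath, Lam.mul_mk, pathMul_single, mul_one]

theorem Lam.induction {R : QuadRel V} {a b : V} {P : Lam k R a b → Prop} (x : Lam k R a b)
    (zero : P 0) (add : ∀ x y, P x → P y → P (x + y)) (smul : ∀ (r : k) x, P x → P (r • x))
    (path : ∀ p, P (Lam.ofPath k R p)) : P x := by
  obtain ⟨f, rfl⟩ := (ideal k R a b).mkQ_surjective x
  induction f using Finsupp.induction_linear with
  | zero => simpa using zero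
  | add f g hf hg => rw [map_add]; exact add _ _ hf hg
  | single p s =>
    rw [← mul_one s, ← smul_eq_mul, ← Finsupp.smul_single, map_smul]
    exact smul _ _ (path p)

theorem Lam.id_mul (R : QuadRel V) {a b : V} (x : Lam k R a b) :
    Lam.mul k R a a b (Lam.ofPath k R Quiver.Path.nil) x = x := by
  induction x using Lam.induction k with
  | zero => simp
  | add x y hx hy => rw [map_add, hx, hy]
  | smul r x hx => rw [map_smul, hx]
  | path p => rw [Lam.mul_ofPath, Quiver.Path.nil_comp]

theorem Lam.mul_id (R : QuadRel V) {a b : V} (x : Lam k R a b) :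
    Lam.mul k R a b b x (Lam.ofPath k R Quiver.Path.nil) = x := by
  induction x using Lam.induction k with
  | zero => simp
  | add x y hx hy => rw [map_add, LinearMap.add_apply, hx, hy]
  | smul r x hx => rw [map_smul, LinearMap.smul_apply, hx]
  | path p => rw [Lam.mul_ofPath, Quiver.Path.comp_nil]

theorem Lam.mul_assoc (R : QuadRel V) {a b c d : V} (x : Lam k R a b) (y : Lam k R b c)
    (z : Lam k R c d) :
    Lam.mul k R a c d (Lam.mul k R a b c x y) z = Lam.mul k R a b d x (Lam.mul k R b c d y z) := by
  induction x using Lam.induction k with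
  | zero => simp
  | add x x' hx hx' => simp only [map_add, LinearMap.add_apply, hx, hx']
  | smul r x hx => simp only [map_smul, LinearMap.smul_apply, hx]
  | path p =>
    induction y using Lam.induction k with
    | zero => simp
    | add x x' hx hx' => simp only [map_add, LinearMap.add_apply, hx, hx']
    | smul r x hx => simp only [map_smul, LinearMap.smul_apply, hx]
    | path q =>
      induction z using Lam.induction k with
      | zero => simp
      | add x x' hx hx' => simp only [map_add, hx, hx']
      | smul r x hx => simp only [map_smul, hx]
      | path r => simp only [Lam.mul_ofPath, Quiver.Path.comp_assoc]

/-- The homogeneous component `Λ(a, b)_n`, spanned by the classes of the paths of length `n`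
(so it is zero for negative `n`). -/
def Lam.component (R : QuadRel V) (a b : V) (n : ℤ) : Submodule k (Lam k R a b) :=
  Submodule.span k {x | ∃ p : Quiver.Path a b, (p.length : ℤ) = n ∧ x = Lam.ofPath k R p}

theorem Lam.mul_mem (R : QuadRel V) {a b c : V} {m n l : ℤ} (h : m + n = l)
    {x : Lam k R a b} (hx : x ∈ Lam.component k R a b m)
    {y : Lam k R b c} (hy : y ∈ Lam.component k R b c n) :
    Lam.mul k R a b c x y ∈ Lam.component k R a c l := by
  induction hx using Submodule.span_induction with
  | zero => simp
  | add x x' _ _ hx hx' => simp only [map_add, LinearMap.add_apply]; exact add_mem hx hx'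
  | smul r x _ hx => simp only [map_smul, LinearMap.smul_apply]; exact Submodule.smul_mem _ _ hx
  | mem x hx =>
    obtain ⟨p, hp, rfl⟩ := hx
    induction hy using Submodule.span_induction with
    | zero => simp
    | add x x' _ _ hx hx' => simp only [map_add]; exact add_mem hx hx'
    | smul r x _ hx => simp only [map_smul]; exact Submodule.smul_mem _ _ hx
    | mem y hy =>
      obtain ⟨q, hq, rfl⟩ := hy
      refine Submodule.subset_span ⟨p.comp q, ?_, Lam.mul_ofPath k R p q⟩
      rw [Quiver.Path.length_comp, Nat.cast_add, hp, hq, h]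

/-- The objects of the degree-zero category attached to the graded `k`-linear category `Λ`:
pairs of a vertex and an integer. -/
@[ext]
structure GrObj (k : Type u) [Field k] {V : Type u} [Quiver.{u} V] (R : QuadRel V) : Type u where
  /-- the vertex -/
  vertex : V
  /-- the degree -/
  deg : ℤ

/-- Morphisms `(x, i) ⟶ (y, j)` are the homogeneous elements of `Λ(x, y)` of degree `j - i`,
composed as in `Λ`. -/
instance (R : QuadRel V) : Category.{u} (GrObj k R) where
  Hom X Y := Lam.component k R X.vertex Y.vertex (Y.deg - X.deg)
  id X := ⟨Lam.ofPath k R Quiver.Path.nil, Submodule.subset_span ⟨Quiver.Path.nil, by simp, rfl⟩⟩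
  comp {X Y Z} f g :=
    ⟨Lam.mul k R _ _ _ f.1 g.1, Lam.mul_mem k R (by ring) f.2 g.2⟩
  id_comp f := Subtype.ext (Lam.id_mul k R f.1)
  comp_id f := Subtype.ext (Lam.mul_id k R f.1)
  assoc f g h := Subtype.ext (Lam.mul_assoc k R f.1 g.1 h.1)

instance (R : QuadRel V) : Preadditive (GrObj k R) where
  homGroup X Y :=
    inferInstanceAs (AddCommGroup (Lam.component k R X.vertex Y.vertex (Y.deg - X.deg)))
  add_comp _ _ _ f f' g := Subtype.ext (LinearMap.map_add₂ (Lam.mul k R _ _ _) f.1 f'.1 g.1)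
  comp_add _ _ _ f g g' := Subtype.ext (map_add (Lam.mul k R _ _ _ f.1) g.1 g'.1)

instance (R : QuadRel V) : Linear k (GrObj k R) where
  homModule X Y :=
    inferInstanceAs (Module k (Lam.component k R X.vertex Y.vertex (Y.deg - X.deg)))
  smul_comp _ _ _ r f g := Subtype.ext (LinearMap.map_smul₂ (Lam.mul k R _ _ _) r f.1 g.1)
  comp_smul _ _ _ f r g := Subtype.ext (map_smul (Lam.mul k R _ _ _ f.1) r g.1)

/-- The ambient abelian category: a functor `M` consists of vector spaces
`M_i(x) = M.obj ⟨x, i⟩` with an action `M_i(x) → M_j(y)` of each element of `Λ(x, y)_{j-i}`,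
compatible with composition. Exactness is computed pointwise. -/
abbrev Rep (R : QuadRel V) : Type (u + 1) := GrObj k R ⥤ ModuleCat.{u} k

instance (R : QuadRel V) : HasFiniteBiproducts (Rep k R) := Abelian.hasFiniteBiproducts

/-- Graded left `Λ`-modules: the action of `Λ(x, y)_{j-i}` is `k`-linear. Morphisms are natural
transformations, i.e. degree-preserving morphisms of modules. -/
def IsGradedModule (R : QuadRel V) : ObjectProperty (Rep k R) :=
  fun M => M.Additive ∧ M.Linear k

/-- For `X = (x, i)`, the shifted indecomposable projective `P_x⟨i⟩`, with
`P_x⟨i⟩_n(y) = Λ(x, y)_{n-i}`. -/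
abbrev projRep (R : QuadRel V) (X : GrObj k R) : Rep k R :=
  (linearCoyoneda k (GrObj k R)).obj (op X)

/-- For `X = (x, i)`, the shifted indecomposable injective `I_x⟨i⟩`, the graded dual
`I_x⟨i⟩_n(y) = Hom_k(Λ(y, x)_{i-n}, k)` of the representable right module; a morphism acts by
precomposition. -/
@[simps]
def injRep (R : QuadRel V) (X : GrObj k R) : Rep k R where
  obj Y := ModuleCat.of k (Module.Dual k (Y ⟶ X))
  map f := ModuleCat.ofHom (Linear.leftComp k X f).dualMap

/-- Finite direct sums of the modules `P_x⟨i⟩`. -/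
def IsProj (R : QuadRel V) : ObjectProperty (Rep k R) :=
  fun P => ∃ (n : ℕ) (X : Fin n → GrObj k R), Nonempty (P ≅ ⨁ fun j => projRep k R (X j))

/-- Finite direct sums of the modules `I_x⟨i⟩`. -/
def IsInj (R : QuadRel V) : ObjectProperty (Rep k R) :=
  fun J => ∃ (n : ℕ) (X : Fin n → GrObj k R), Nonempty (J ≅ ⨁ fun j => injRep k R (X j))

/-- Exactness of `X ⟶ Y ⟶ Z` at `Y` (including that the composite vanishes). -/
def ExactAt {C : Type*} [Category* C] [HasZeroMorphisms C] {X Y Z : C} (f : X ⟶ Y) (g : Y ⟶ Z) :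
    Prop :=
  ∃ w : f ≫ g = 0, (ShortComplex.mk f g w).Exact

/-- Finitely presented graded modules: there is an exact sequence `P₁ ⟶ P₀ ⟶ M ⟶ 0`. -/
def IsFP (R : QuadRel V) : ObjectProperty (Rep k R) := fun M =>
  IsGradedModule k R M ∧ ∃ (P₁ P₀ : Rep k R) (d : P₁ ⟶ P₀) (ε : P₀ ⟶ M),
    IsProj k R P₁ ∧ IsProj k R P₀ ∧ ExactAt d ε ∧ Epi ε

/-- Finitely copresented graded modules: there is an exact sequence `0 ⟶ N ⟶ I⁰ ⟶ I¹`. -/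
def IsFCP (R : QuadRel V) : ObjectProperty (Rep k R) := fun N =>
  IsGradedModule k R N ∧ ∃ (J₀ J₁ : Rep k R) (η : N ⟶ J₀) (d : J₀ ⟶ J₁),
    IsInj k R J₀ ∧ IsInj k R J₁ ∧ Mono η ∧ ExactAt η d

/-- Perfect graded modules: there is an exact sequence
`0 ⟶ P n ⟶ ⋯ ⟶ P 1 ⟶ P 0 ⟶ M ⟶ 0` (extended by zero beyond `P n`). -/
def IsPerfect (R : QuadRel V) : ObjectProperty (Rep k R) := fun M =>
  IsGradedModule k R M ∧ ∃ (n : ℕ) (P : ℕ → Rep k R) (d : ∀ i, P (i + 1) ⟶ P i) (ε : P 0 ⟶ M),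
    (∀ i, IsProj k R (P i)) ∧ (∀ i, n < i → IsZero (P i)) ∧
    Epi ε ∧ ExactAt (d 0) ε ∧ ∀ i, ExactAt (d (i + 1)) (d i)

/-- Coperfect graded modules: there is an exact sequence
`0 ⟶ N ⟶ J 0 ⟶ J 1 ⟶ ⋯ ⟶ J n ⟶ 0` (extended by zero beyond `J n`). -/
def IsCoperfect (R : QuadRel V) : ObjectProperty (Rep k R) := fun N =>
  IsGradedModule k R N ∧ ∃ (n : ℕ) (J : ℕ → Rep k R) (d : ∀ i, J i ⟶ J (i + 1)) (η : N ⟶ J 0),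
    (∀ i, IsInj k R (J i)) ∧ (∀ i, n < i → IsZero (J i)) ∧
    Mono η ∧ ExactAt η (d 0) ∧ ∀ i, ExactAt (d i) (d (i + 1))

/-- Finite-dimensional graded modules: all `M_i(x)` are finite-dimensional and only finitely many
are nonzero. -/
def IsFinDim (R : QuadRel V) : ObjectProperty (Rep k R) := fun M =>
  IsGradedModule k R M ∧ (∀ X, Module.Finite k (M.obj X)) ∧ {X | Nontrivial (M.obj X)}.Finite

/-- The full subcategory `𝒜` of graded modules is abelian, the finite-dimensional graded modules
form a Serre subcategory of it (in particular they all belong to `𝒜`), and the Serre quotient of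
`𝒜` by the finite-dimensional graded modules is an abelian category. -/
def AbelianWithAbelianTails (R : QuadRel V) (A : ObjectProperty (Rep k R)) : Prop :=
  IsFinDim k R ≤ A ∧
  ∃ (_ : Abelian A.FullSubcategory) (_ : ((IsFinDim k R).inverseImage A.ι).IsSerreClass),
    Nonempty (Abelian ((IsFinDim k R).inverseImage A.ι).isoModSerre.Localization)

/-- The relations of the quadratic dual `Λ^! = kQᵒᵖ/I^!`: the monomial "first `βᵒᵖ`, then `αᵒᵖ`"
is a generator of `I^!` exactly when the path "first `α`, then `β`" does not lie in `I`. -/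
def QuadRel.dual (R : QuadRel V) : QuadRel Vᵒᵖ :=
  fun _ _ _ β α => Finsupp.single (α.unop.toPath.comp β.unop.toPath) (1 : k) ∉ ideal k R _ _

end

end QuadMon

/-! Finite-dimensionality of `Λ` bounds the lengths of its nonzero paths. A composite of two arrows
that is a relation in `Λ^!` comes from a path of length two that survives in `Λ`, so the arrows of
`Λ^!` carry a bounded rank that changes strictly along every forbidden composite
(`exists_rank_dual`).

The other ingredient is an intrinsic description of finitely presented modules. A module is tame
above degree `n` (`Tame`) if, above `n`, it is the direct sum of the images of the arrows, and each
arrow `γ` is injective on the sum of the images of those `δ` for which "`δ`, then `γ`" is not a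
relation. Representables are tame: paths avoiding the relations form a basis, and whether such a
path can be prolonged by an arrow depends only on the arrow it meets. Tameness passes to cokernels,
and to kernels at the cost of one degree (`Tame.cokernel`, `Tame.kernel`). Hence the class `IsTame`
of tame, locally finite-dimensional modules bounded below is closed under kernels, cokernels and
finite sums, and contains all finitely presented modules.

Conversely a tame module is perfect. Stripping off its lowest degrees one at a time and using the
horseshoe lemma reduces to modules that live in degrees at least `n` and are tame above `n`
(`exists_hasRes`). These are generated in degree `n`, and the kernel of the obvious cover is of the
same kind for `n + 1`. In that kernel an arrow `γ` can only kill combinations of arrows `δ` whose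
composite with `γ` is forbidden, and these have larger rank. So if arrows of rank at least `r + 1`
are injective on the bottom degree of the module, then arrows of rank at least `r` are injective on
the bottom degree of its syzygy. Starting from the bound on the rank, where nothing is assumed, one
reaches a module on which all arrows are injective, and that module is projective
(`hasRes_of_pure`). Thus perfect, finitely presented and tame coincide.

Finite-dimensional modules are tame because they vanish in high degrees, which gives the Serre
subcategory and the tails quotient. The copresented half follows by `k`-duality from the same
argument on the opposite category. -/

namespace QuadMon

noncomputable section

/-! ### Exactness and linearity of functors, checked objectwise -/

section Pointwise

variable {k : Type u} [Field k] {C : Type u} [Category.{u} C]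

/-- Evaluations commute with homology and jointly detect zero functors. All later exactness
arguments become chases with elements. -/
theorem exactAt_iff_app {M N Q : C ⥤ ModuleCat.{u} k} (f : M ⟶ N) (g : N ⟶ Q) :
    ExactAt f g ↔ ∀ X, Function.Exact (f.app X) (g.app X) := by
  constructor
  · rintro ⟨w, h⟩ X
    have h' := h.map ((evaluation C (ModuleCat.{u} k)).obj X)
    exact (ShortComplex.ShortExact.moduleCat_exact_iff_function_exact _).1 h'
  · intro h
    have w : f ≫ g = 0 := by
      ext X x
      exact (h X).apply_apply_eq_zero x
    refine ⟨w, ?_⟩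
    rw [ShortComplex.exact_iff_isZero_homology]
    refine (Functor.isZero_iff _).2 fun X => ?_
    have e := (ShortComplex.mk f g w).mapHomologyIso ((evaluation C (ModuleCat.{u} k)).obj X)
    refine IsZero.of_iso ?_ e.symm
    rw [← ShortComplex.exact_iff_isZero_homology]
    exact (ShortComplex.ShortExact.moduleCat_exact_iff_function_exact _).2 (h X)

theorem mono_iff_app {M N : C ⥤ ModuleCat.{u} k} (f : M ⟶ N) :
    Mono f ↔ ∀ X, Function.Injective (f.app X) := by
  simp only [NatTrans.mono_iff_mono_app, ModuleCat.mono_iff_injective]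

theorem epi_iff_app {M N : C ⥤ ModuleCat.{u} k} (f : M ⟶ N) :
    Epi f ↔ ∀ X, Function.Surjective (f.app X) := by
  simp only [NatTrans.epi_iff_epi_app, ModuleCat.epi_iff_surjective]

theorem bijective_app_of_iso {M N : C ⥤ ModuleCat.{u} k} (e : M ≅ N) (X : C) :
    Function.Bijective (e.hom.app X) :=
  ⟨(mono_iff_app e.hom).1 inferInstance X, (epi_iff_app e.hom).1 inferInstance X⟩

theorem isZero_iff_app {M : C ⥤ ModuleCat.{u} k} :
    IsZero M ↔ ∀ X, Subsingleton (M.obj X) := by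
  simp only [Functor.isZero_iff, ModuleCat.isZero_iff_subsingleton]

theorem nonempty_iso_of_bijective {M N : C ⥤ ModuleCat.{u} k} (f : M ⟶ N)
    (h : ∀ X, Function.Bijective (f.app X)) : Nonempty (M ≅ N) := by
  have : Mono f := (mono_iff_app f).2 fun X => (h X).1
  have : Epi f := (epi_iff_app f).2 fun X => (h X).2
  have : IsIso f := isIso_of_mono_of_epi f
  exact ⟨asIso f⟩

theorem naturality_app {M N : C ⥤ ModuleCat.{u} k} (f : M ⟶ N) {X Y : C} (a : X ⟶ Y)
    (x : M.obj X) : f.app Y (M.map a x) = N.map a (f.app X x) := by simp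

theorem exactAt_of_isLimit {M N : C ⥤ ModuleCat.{u} k} {f : M ⟶ N} {c : KernelFork f}
    (hc : IsLimit c) : ExactAt c.ι f :=
  ⟨c.condition, (ShortComplex.mk _ _ c.condition).exact_of_f_is_kernel
    (IsLimit.ofIsoLimit hc (Fork.ext (Iso.refl _)))⟩

theorem exactAt_of_isColimit {M N : C ⥤ ModuleCat.{u} k} {f : M ⟶ N} {c : CokernelCofork f}
    (hc : IsColimit c) : ExactAt f c.π :=
  ⟨c.condition, (ShortComplex.mk _ _ c.condition).exact_of_g_is_cokernel
    (IsColimit.ofIsoColimit hc (Cofork.ext (Iso.refl _)))⟩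

instance : HasFiniteBiproducts (C ⥤ ModuleCat.{u} k) := Abelian.hasFiniteBiproducts

variable [Preadditive C] [Linear k C]

variable (k C) in
/-- Functors that are `k`-linear on morphisms. -/
def IsLin : ObjectProperty (C ⥤ ModuleCat.{u} k) := fun M => M.Additive ∧ M.Linear k

theorem IsLin.map_add {M : C ⥤ ModuleCat.{u} k} (hM : IsLin k C M) {X Y : C} (f g : X ⟶ Y)
    (m : M.obj X) : M.map (f + g) m = M.map f m + M.map g m := by
  have := hM.1
  simp [Functor.map_add]

theorem IsLin.map_smul {M : C ⥤ ModuleCat.{u} k} (hM : IsLin k C M) {X Y : C} (r : k) (f : X ⟶ Y)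
    (m : M.obj X) : M.map (r • f) m = r • M.map f m := by
  have := hM.1
  have := hM.2
  simp [Functor.map_smul]

theorem IsLin.map_zero {M : C ⥤ ModuleCat.{u} k} (hM : IsLin k C M) {X Y : C}
    (m : M.obj X) : M.map (0 : X ⟶ Y) m = 0 := by
  have := hM.1
  simp

theorem IsLin.mk' {M : C ⥤ ModuleCat.{u} k}
    (hadd : ∀ {X Y : C} (f g : X ⟶ Y) (m : M.obj X), M.map (f + g) m = M.map f m + M.map g m)
    (hsmul : ∀ {X Y : C} (r : k) (f : X ⟶ Y) (m : M.obj X), M.map (r • f) m = r • M.map f m) :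
    IsLin k C M := by
  refine ⟨⟨?_⟩, ⟨?_⟩⟩
  · intro X Y f g
    ext m
    simpa using hadd f g m
  · intro X Y f r
    ext m
    simpa using hsmul r f m

theorem IsLin.of_injective {K M : C ⥤ ModuleCat.{u} k} (hM : IsLin k C M) (i : K ⟶ M)
    (hi : ∀ X, Function.Injective (i.app X)) : IsLin k C K := by
  refine IsLin.mk' (fun f g m => hi _ ?_) (fun r f m => hi _ ?_)
  · rw [_root_.map_add]
    simp only [naturality_app, hM.map_add]
  · rw [_root_.map_smul]
    simp only [naturality_app, hM.map_smul]

theorem IsLin.of_surjective {M Q : C ⥤ ModuleCat.{u} k} (hM : IsLin k C M) (p : M ⟶ Q)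
    (hp : ∀ X, Function.Surjective (p.app X)) : IsLin k C Q := by
  refine IsLin.mk' (fun {X Y} f g m => ?_) (fun {X Y} r f m => ?_)
  · obtain ⟨m, rfl⟩ := hp X m
    simp only [← naturality_app, hM.map_add, _root_.map_add]
  · obtain ⟨m, rfl⟩ := hp X m
    simp only [← naturality_app, hM.map_smul, _root_.map_smul]

end Pointwise

/-! ### Tame functors; stability under kernels and cokernels -/

section Tame

variable (C : Type u) [Category.{u} C] [Preadditive C]

/-- A grading of the objects of a preadditive category, together with a choice of arrows of degree
one ending at each object, a relation saying which composites of two arrows are allowed to be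
nonzero, and a rank that drops along the forbidden composites. -/
structure ArrowSystem where
  /-- the degree of an object -/
  deg : C → ℤ
  /-- the arrows ending at a given object -/
  In : C → Type u
  fintype : ∀ Y, Fintype (In Y)
  /-- the source of an arrow -/
  src : ∀ {Y : C}, In Y → C
  /-- the morphism given by an arrow -/
  arr : ∀ {Y : C} (γ : In Y), src γ ⟶ Y
  /-- `legal γ δ` says that the composite "first `δ`, then `γ`" is not a relation -/
  legal : ∀ {Y : C} (γ : In Y), In (src γ) → Prop
  /-- the rank of an arrow -/
  rk : ∀ {Y : C}, In Y → ℕ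
  deg_src : ∀ {Y : C} (γ : In Y), deg (src γ) + 1 = deg Y
  comp_eq_zero : ∀ {Y : C} (γ : In Y) (δ : In (src γ)), ¬ legal γ δ → arr δ ≫ arr γ = 0
  rk_lt : ∀ {Y : C} (γ : In Y) (δ : In (src γ)), ¬ legal γ δ → rk γ < rk δ

attribute [instance] ArrowSystem.fintype

variable {C} {k : Type u} [Field k] (A : ArrowSystem C)

/-- The action of an arrow on a functor. -/
def ArrowSystem.act (M : C ⥤ ModuleCat.{u} k) {Y : C} (γ : A.In Y) :
    M.obj (A.src γ) →ₗ[k] M.obj Y := (M.map (A.arr γ)).hom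

theorem ArrowSystem.app_act {M N : C ⥤ ModuleCat.{u} k} (f : M ⟶ N) {Y : C} (γ : A.In Y)
    (m : M.obj (A.src γ)) : f.app Y (A.act M γ m) = A.act N γ (f.app _ m) :=
  naturality_app f (A.arr γ) m

theorem ArrowSystem.app_sum_act {M N : C ⥤ ModuleCat.{u} k} (f : M ⟶ N) {Y : C}
    (c : ∀ γ : A.In Y, M.obj (A.src γ)) :
    f.app Y (∑ γ, A.act M γ (c γ)) = ∑ γ, A.act N γ (f.app _ (c γ)) := by
  rw [map_sum]
  exact Finset.sum_congr rfl fun γ _ => A.app_act f γ (c γ)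

/-- Above degree `n`, the functor `M` is the direct sum of the images of the arrows, and an arrow
is injective on the sum of the images of the arrows it can be legally composed with. -/
structure Tame (M : C ⥤ ModuleCat.{u} k) (n : ℤ) : Prop where
  span : ∀ Y, n < A.deg Y → ∀ m : M.obj Y, ∃ c : ∀ γ : A.In Y, M.obj (A.src γ),
    m = ∑ γ, A.act M γ (c γ)
  indep : ∀ Y, n < A.deg Y → ∀ c : ∀ γ : A.In Y, M.obj (A.src γ),
    ∑ γ, A.act M γ (c γ) = 0 → ∀ γ, A.act M γ (c γ) = 0
  inj : ∀ Y (γ : A.In Y), n < A.deg (A.src γ) → ∀ c : ∀ δ : A.In (A.src γ), M.obj (A.src δ),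
    (∀ δ, ¬ A.legal γ δ → c δ = 0) → A.act M γ (∑ δ, A.act M δ (c δ)) = 0 →
      ∑ δ, A.act M δ (c δ) = 0

variable {A}

theorem Tame.mono {M : C ⥤ ModuleCat.{u} k} {n n' : ℤ} (h : Tame A M n) (hn : n ≤ n') :
    Tame A M n' where
  span Y hY := h.span Y (hn.trans_lt hY)
  indep Y hY := h.indep Y (hn.trans_lt hY)
  inj Y γ hY := h.inj Y γ (hn.trans_lt hY)

theorem Tame.of_subsingleton {M : C ⥤ ModuleCat.{u} k} {n : ℤ}
    (h : ∀ X, n < A.deg X → Subsingleton (M.obj X)) : Tame A M n where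
  span Y hY _ := have := h Y hY; ⟨0, Subsingleton.elim _ _⟩
  indep Y hY _ _ _ := have := h Y hY; Subsingleton.elim _ _
  inj _ _ hY _ _ _ := have := h _ hY; Subsingleton.elim _ _

theorem Tame.pi {ι : Type*} [Finite ι] {F : ι → (C ⥤ ModuleCat.{u} k)} {L : C ⥤ ModuleCat.{u} k}
    {n : ℤ} (p : ∀ j, L ⟶ F j) (hp : ∀ X, Function.Bijective fun (x : L.obj X) j => (p j).app X x)
    (h : ∀ j, Tame A (F j) n) : Tame A L n where
  span Y hY m := by
    choose c hc using fun j => (h j).span Y hY ((p j).app Y m)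
    choose d hd using fun γ : A.In Y => (hp (A.src γ)).2 fun j => c j γ
    refine ⟨d, (hp Y).1 (funext fun j => ?_)⟩
    dsimp only
    rw [hc, A.app_sum_act]
    exact Finset.sum_congr rfl fun γ _ => congrArg _ (congrFun (hd γ) j).symm
  indep Y hY c hc γ := by
    refine (hp Y).1 (funext fun j => ?_)
    dsimp only
    rw [A.app_act, map_zero]
    refine (h j).indep Y hY (fun γ => (p j).app _ (c γ)) ?_ γ
    rw [← A.app_sum_act, hc, map_zero]
  inj Y γ hY c hc h0 := by
    refine (hp _).1 (funext fun j => ?_)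
    dsimp only
    rw [A.app_sum_act, map_zero]
    refine (h j).inj Y γ hY (fun δ => (p j).app _ (c δ)) (fun δ hδ => by rw [hc δ hδ, map_zero]) ?_
    rw [← A.app_sum_act, ← A.app_act, h0, map_zero]

/-- A graded Nakayama argument: above `n` each element of `N` is a combination of arrows applied to
elements one degree lower, so preimages can be built by induction on the degree. -/
theorem surjective_of_tame {M N : C ⥤ ModuleCat.{u} k} {n : ℤ} (tN : Tame A N n) (f : M ⟶ N)
    (h : ∀ X, A.deg X ≤ n → Function.Surjective (f.app X)) (X : C) :
    Function.Surjective (f.app X) := by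
  suffices ∀ (d : ℕ) X, A.deg X ≤ n + d → Function.Surjective (f.app X) from
    this (A.deg X - n).toNat X (by omega)
  intro d
  induction d with
  | zero => simpa using h
  | succ d ih =>
    intro X hX y
    by_cases hn : A.deg X ≤ n
    · exact h X hn y
    obtain ⟨c, rfl⟩ := tN.span X (by omega) y
    choose b hb using fun γ : A.In X => ih (A.src γ) (by have := A.deg_src γ; omega) (c γ)
    refine ⟨∑ γ, A.act M γ (b γ), ?_⟩
    rw [A.app_sum_act]
    simp only [hb]

theorem subsingleton_of_tame {M : C ⥤ ModuleCat.{u} k} {n : ℤ} (tM : Tame A M n)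
    (h : ∀ X, A.deg X ≤ n → Subsingleton (M.obj X)) (X : C) : Subsingleton (M.obj X) := by
  have := surjective_of_tame tM (0 : M ⟶ M) (fun X hX y => ⟨0, (h X hX).elim _ _⟩) X
  refine subsingleton_of_forall_eq 0 fun y => ?_
  obtain ⟨x, rfl⟩ := this y
  rfl

variable [Linear k C]

theorem ArrowSystem.act_act_eq_zero (A : ArrowSystem C) {M : C ⥤ ModuleCat.{u} k}
    (hM : IsLin k C M) {Y : C} (γ : A.In Y) (δ : A.In (A.src γ)) (h : ¬ A.legal γ δ) (m : M.obj (A.src δ)) :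
    A.act M γ (A.act M δ m) = 0 := by
  have : A.act M γ (A.act M δ m) = M.map (A.arr δ ≫ A.arr γ) m := by simp [ArrowSystem.act]
  rw [this, A.comp_eq_zero γ δ h, hM.map_zero]

/-- The terms with a forbidden composite are killed by `γ`, so they may be discarded. This puts an
argument of `γ` in the form on which `Tame.inj` applies. -/
theorem exists_legal {M : C ⥤ ModuleCat.{u} k} (hM : IsLin k C M) {Y : C} (γ : A.In Y)
    (c : ∀ δ : A.In (A.src γ), M.obj (A.src δ)) :
    ∃ c' : ∀ δ : A.In (A.src γ), M.obj (A.src δ), (∀ δ, ¬ A.legal γ δ → c' δ = 0) ∧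
      (∀ δ, A.legal γ δ → c' δ = c δ) ∧
      A.act M γ (∑ δ, A.act M δ (c δ)) = A.act M γ (∑ δ, A.act M δ (c' δ)) := by
  classical
  refine ⟨fun δ => if A.legal γ δ then c δ else 0, fun δ h => if_neg h, fun δ h => if_pos h, ?_⟩
  simp only [map_sum]
  refine Finset.sum_congr rfl fun δ _ => ?_
  by_cases h : A.legal γ δ
  · simp only [if_pos h]
  · simp only [if_neg h, map_zero, A.act_act_eq_zero hM γ δ h]

theorem Tame.exists_legal_of_act {M : C ⥤ ModuleCat.{u} k} {n : ℤ} (h : Tame A M n)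
    (hM : IsLin k C M) {Y : C} (γ : A.In Y) (hn : n < A.deg (A.src γ)) (m : M.obj (A.src γ)) :
    ∃ c : ∀ δ : A.In (A.src γ), M.obj (A.src δ), (∀ δ, ¬ A.legal γ δ → c δ = 0) ∧
      A.act M γ m = A.act M γ (∑ δ, A.act M δ (c δ)) := by
  obtain ⟨c, rfl⟩ := h.span _ hn m
  obtain ⟨c', h1, -, h2⟩ := exists_legal hM γ c
  exact ⟨c', h1, h2⟩

/-- Independence and injectivity restrict to subfunctors; spanning is the issue. If `m` in `K` is `∑
γ c_γ` in `M`, independence in `N` gives `γ (f c_γ) = 0`. Once `c_γ` is replaced by a legal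
combination with the same image under `γ`, injectivity in `N` puts it in `K`. This uses tameness at
the source of `γ`, whence the shift to `n + 1`. -/
theorem Tame.kernel {K M N : C ⥤ ModuleCat.{u} k} {n : ℤ} (i : K ⟶ M) (f : M ⟶ N)
    (hM : IsLin k C M) (hi : ∀ X, Function.Injective (i.app X))
    (hif : ∀ X, Function.Exact (i.app X) (f.app X)) (tM : Tame A M n) (tN : Tame A N n) :
    Tame A K (n + 1) where
  span Y hY m := by
    obtain ⟨c, hc⟩ := tM.span Y (by omega) (i.app Y m)
    have h0 : ∑ γ, A.act N γ (f.app _ (c γ)) = 0 := by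
      rw [← A.app_sum_act, ← hc, (hif Y).apply_apply_eq_zero]
    have key : ∀ γ : A.In Y, ∃ x : K.obj (A.src γ), A.act M γ (i.app _ x) = A.act M γ (c γ) := by
      intro γ
      have hd := A.deg_src γ
      obtain ⟨b, hb, hb'⟩ := tM.exists_legal_of_act hM γ (by omega) (c γ)
      have h1 := tN.indep Y (by omega) _ h0 γ
      rw [← A.app_act, hb', A.app_act, A.app_sum_act] at h1
      have h2 := tN.inj Y γ (by omega) (fun δ => f.app _ (b δ))
        (fun δ hδ => by rw [hb δ hδ, map_zero]) h1
      rw [← A.app_sum_act] at h2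
      obtain ⟨x, hx⟩ := (hif _ _).1 h2
      exact ⟨x, by rw [hx, hb']⟩
    choose x hx using key
    refine ⟨x, hi Y ?_⟩
    rw [A.app_sum_act, hc]
    exact Finset.sum_congr rfl fun γ _ => (hx γ).symm
  indep Y hY c hc γ := by
    apply hi Y
    rw [A.app_act, map_zero]
    refine tM.indep Y (by omega) (fun γ => i.app _ (c γ)) ?_ γ
    rw [← A.app_sum_act, hc, map_zero]
  inj Y γ hY c hc h := by
    apply hi _
    rw [A.app_sum_act, map_zero]
    refine tM.inj Y γ (by omega) (fun δ => i.app _ (c δ)) (fun δ hδ => by rw [hc δ hδ, map_zero]) ?_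
    rw [← A.app_sum_act, ← A.app_act, h, map_zero]

/-- Here spanning is clear. For the other two conditions, a relation in `Q` lifts to an equality in
`N` with an element `f m`; expanding `m` along arrows and using independence in `N` splits this
equality arrow by arrow. -/
theorem Tame.cokernel {M N Q : C ⥤ ModuleCat.{u} k} {n : ℤ} (f : M ⟶ N) (p : N ⟶ Q)
    (hM : IsLin k C M) (hp : ∀ X, Function.Surjective (p.app X))
    (hfp : ∀ X, Function.Exact (f.app X) (p.app X)) (tM : Tame A M n) (tN : Tame A N n) :
    Tame A Q n where
  span Y hY q := by
    obtain ⟨m, rfl⟩ := hp Y q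
    obtain ⟨c, rfl⟩ := tN.span Y hY m
    exact ⟨fun γ => p.app _ (c γ), A.app_sum_act p c⟩
  indep Y hY c hc γ := by
    choose b hb using fun γ : A.In Y => hp _ (c γ)
    obtain rfl : (fun γ => p.app _ (b γ)) = c := funext hb
    rw [← A.app_sum_act] at hc
    obtain ⟨m, hm⟩ := (hfp _ _).1 hc
    obtain ⟨e, rfl⟩ := tM.span Y hY m
    have h0 : ∑ γ, A.act N γ (b γ - f.app _ (e γ)) = 0 := by
      simp only [map_sub, Finset.sum_sub_distrib]
      rw [← hm, A.app_sum_act, sub_self]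
    have h1 := congrArg (p.app Y) (tN.indep Y hY _ h0 γ)
    rw [A.app_act, map_sub, (hfp _).apply_apply_eq_zero, sub_zero, map_zero] at h1
    exact h1
  inj Y γ hY c hc h := by
    classical
    have hd := A.deg_src γ
    have : ∀ δ : A.In (A.src γ), ∃ b : N.obj (A.src δ), p.app _ b = c δ ∧
        (¬ A.legal γ δ → b = 0) := by
      intro δ
      by_cases hδ : A.legal γ δ
      · obtain ⟨b, hb⟩ := hp _ (c δ)
        exact ⟨b, hb, fun h => (h hδ).elim⟩
      · exact ⟨0, by rw [hc δ hδ, map_zero], fun _ => rfl⟩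
    choose b hb hb0 using this
    obtain rfl : (fun δ => p.app _ (b δ)) = c := funext hb
    rw [← A.app_sum_act, ← A.app_act] at h
    obtain ⟨m, hm⟩ := (hfp _ _).1 h
    obtain ⟨e, rfl⟩ := tM.span Y (by omega) m
    set x := ∑ δ, A.act N δ (b δ) with hx
    -- The element `γ x` is written as a sum over all arrows concentrated at `γ`, so that
    -- independence in `N` compares it with `f m` and yields `γ x = γ (f (e γ))`.
    have hs : ∑ ε, A.act N ε ((Pi.single γ x : ∀ ε : A.In Y, N.obj (A.src ε)) ε) = A.act N γ x := by
      rw [Finset.sum_eq_single γ]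
      · rw [Pi.single_eq_same]
      · intro ε _ hε
        rw [Pi.single_eq_of_ne hε, map_zero]
      · simp
    have h0 : ∑ ε, A.act N ε
        ((Pi.single γ x : ∀ ε : A.In Y, N.obj (A.src ε)) ε - f.app _ (e ε)) = 0 := by
      simp only [map_sub, Finset.sum_sub_distrib]
      rw [hs, ← hm, A.app_sum_act, sub_self]
    have h1 := tN.indep Y (by omega) _ h0 γ
    rw [Pi.single_eq_same, map_sub, sub_eq_zero, ← A.app_act] at h1
    obtain ⟨a, ha, ha'⟩ := tM.exists_legal_of_act hM γ hY (e γ)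
    rw [ha', A.app_act, ← sub_eq_zero, ← map_sub, A.app_sum_act, hx, ← Finset.sum_sub_distrib] at h1
    simp only [← map_sub] at h1
    have h2 := tN.inj Y γ hY _ (fun δ hδ => by rw [hb0 δ hδ, ha δ hδ, map_zero, sub_zero]) h1
    simp only [map_sub, Finset.sum_sub_distrib] at h2
    rw [sub_eq_zero, ← A.app_sum_act] at h2
    rw [← A.app_sum_act, h2, (hfp _).apply_apply_eq_zero]

end Tame

/-! ### Biproducts, representables and their lifting property -/

section Free

variable {k : Type u} [Field k] {C : Type u} [Category.{u} C]

theorem biproduct_eq_sum {ι : Type} [Fintype ι] (F : ι → (C ⥤ ModuleCat.{u} k)) {X : C}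
    (x : (⨁ F).obj X) : x = ∑ j, (biproduct.ι F j).app X ((biproduct.π F j).app X x) := by
  have h : 𝟙 (⨁ F) = ∑ j, biproduct.π F j ≫ biproduct.ι F j := biproduct.total.symm
  have := congrArg (fun f : (⨁ F) ⟶ (⨁ F) => (f.app X).hom x) h
  refine this.trans ?_
  simp only [NatTrans.app_sum, ModuleCat.hom_sum, LinearMap.sum_apply]
  rfl

theorem biproduct_bijective {ι : Type} [Finite ι] (F : ι → (C ⥤ ModuleCat.{u} k)) (X : C) :
    Function.Bijective fun (x : (⨁ F).obj X) j => (biproduct.π F j).app X x := by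
  classical
  have := Fintype.ofFinite ι
  constructor
  · intro x y h
    rw [biproduct_eq_sum F x, biproduct_eq_sum F y]
    exact Finset.sum_congr rfl fun j _ => congrArg _ (congrFun h j)
  · intro c
    refine ⟨∑ j, (biproduct.ι F j).app X (c j), funext fun j => ?_⟩
    dsimp only
    rw [map_sum, Finset.sum_eq_single j]
    · exact congrArg (fun f : F j ⟶ F j => (f.app X).hom (c j)) (biproduct.ι_π_self F j)
    · intro i _ hi
      exact congrArg (fun f : F i ⟶ F j => (f.app X).hom (c i)) (biproduct.ι_π_ne F hi)
    · simp

theorem biprod_bijective (M N : C ⥤ ModuleCat.{u} k) (X : C) :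
    Function.Bijective fun x : (M ⊞ N).obj X =>
      ((biprod.fst : M ⊞ N ⟶ M).app X x, (biprod.snd : M ⊞ N ⟶ N).app X x) := by
  constructor
  · have hx : ∀ x : (M ⊞ N).obj X, x = (biprod.inl : M ⟶ M ⊞ N).app X ((biprod.fst : M ⊞ N ⟶ M).app X x) +
        (biprod.inr : N ⟶ M ⊞ N).app X ((biprod.snd : M ⊞ N ⟶ N).app X x) := fun x =>
      congrArg (fun f : M ⊞ N ⟶ M ⊞ N => (f.app X).hom x) biprod.total.symm
    intro x y h
    obtain ⟨h1, h2⟩ := Prod.ext_iff.1 h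
    dsimp only at h1 h2
    rw [hx x, hx y, h1, h2]
  · rintro ⟨m, n⟩
    refine ⟨(biprod.inl : M ⟶ M ⊞ N).app X m + (biprod.inr : N ⟶ M ⊞ N).app X n, ?_⟩
    have h1 : (biprod.fst : M ⊞ N ⟶ M).app X ((biprod.inl : M ⟶ M ⊞ N).app X m) = m :=
      congrArg (fun f : M ⟶ M => (f.app X).hom m) biprod.inl_fst
    have h2 : (biprod.snd : M ⊞ N ⟶ N).app X ((biprod.inl : M ⟶ M ⊞ N).app X m) = 0 :=
      congrArg (fun f : M ⟶ N => (f.app X).hom m) biprod.inl_snd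
    have h3 : (biprod.fst : M ⊞ N ⟶ M).app X ((biprod.inr : N ⟶ M ⊞ N).app X n) = 0 :=
      congrArg (fun f : N ⟶ M => (f.app X).hom n) biprod.inr_fst
    have h4 : (biprod.snd : M ⊞ N ⟶ N).app X ((biprod.inr : N ⟶ M ⊞ N).app X n) = n :=
      congrArg (fun f : N ⟶ N => (f.app X).hom n) biprod.inr_snd
    simp only [map_add, h1, h2, h3, h4, zero_add, add_zero]

theorem nonempty_iso_biproduct {ι : Type} [Finite ι] {F : ι → (C ⥤ ModuleCat.{u} k)}
    {L : C ⥤ ModuleCat.{u} k} (p : ∀ j, L ⟶ F j)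
    (hp : ∀ X, Function.Bijective fun (x : L.obj X) j => (p j).app X x) : Nonempty (L ≅ ⨁ F) := by
  refine nonempty_iso_of_bijective (biproduct.lift p) fun X => ?_
  rw [← Function.Bijective.of_comp_iff' (biproduct_bijective F X)]
  convert hp X using 1
  ext x j
  exact congrArg (fun f : L ⟶ F j => (f.app X).hom x) (biproduct.lift_π p j)

theorem isClosedUnderFiniteProducts_of_pi {Q : ObjectProperty (C ⥤ ModuleCat.{u} k)}
    (hQ : ∀ {ι : Type} [Finite ι] {F : ι → (C ⥤ ModuleCat.{u} k)} {L : C ⥤ ModuleCat.{u} k}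
      (p : ∀ j, L ⟶ F j), (∀ X, Function.Bijective fun (x : L.obj X) j => (p j).app X x) →
      (∀ j, Q (F j)) → Q L) : Q.IsClosedUnderFiniteProducts where
  isClosedUnderLimitsOfShape J _ := ⟨by
    rintro L ⟨c⟩
    let F : J → (C ⥤ ModuleCat.{u} k) := fun j => c.diag.obj ⟨j⟩
    let e : L ≅ ⨁ F := (c.isLimit.conePointUniqueUpToIso
      ((IsLimit.postcomposeHomEquiv Discrete.natIsoFunctor.symm _).symm
        (biproduct.isLimit F)))
    refine hQ (fun j => e.hom ≫ biproduct.π F j) (fun X => ?_) fun j => c.prop_diag_obj ⟨j⟩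
    exact (biproduct_bijective F X).comp (bijective_app_of_iso e X)⟩

variable [Preadditive C] [Linear k C]

variable (k) in
/-- The representable functor `Hom(X, -)`. -/
abbrev coy (X : C) : C ⥤ ModuleCat.{u} k := (linearCoyoneda k C).obj (op X)

theorem coy_map_apply {X Y Z : C} (g : Y ⟶ Z) (f : X ⟶ Y) :
    (coy k X).map g f = f ≫ g := rfl

theorem isLin_coy (X : C) : IsLin k C (coy k X) :=
  IsLin.mk' (fun _ _ _ => Preadditive.comp_add _ _ _ _ _ _) (fun _ _ _ => Linear.comp_smul _ _ _ _ _ _)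

/-- The morphism from a representable functor given by an element. -/
def yonedaMap {M : C ⥤ ModuleCat.{u} k} (hM : IsLin k C M) {X : C} (m : M.obj X) : coy k X ⟶ M where
  app Y := ModuleCat.ofHom
    { toFun := fun f : X ⟶ Y => M.map f m
      map_add' := fun f g => hM.map_add f g m
      map_smul' := fun r f => hM.map_smul r f m }
  naturality Y Z g := by
    ext f
    exact congrArg (fun a : M.obj X ⟶ M.obj Z => a.hom m) (M.map_comp (X := X) f g)

theorem coy_app {M : C ⥤ ModuleCat.{u} k} {X Y : C} (φ : coy k X ⟶ M) (f : X ⟶ Y) :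
    φ.app Y f = M.map f (φ.app X (𝟙 X)) := by
  have h := naturality_app φ f (𝟙 X)
  rw [coy_map_apply] at h
  exact (congrArg (φ.app Y) (Category.id_comp f)).symm.trans h

theorem coy_hom_ext {M : C ⥤ ModuleCat.{u} k} {X : C} {φ ψ : coy k X ⟶ M}
    (h : φ.app X (𝟙 X) = ψ.app X (𝟙 X)) : φ = ψ := by
  ext Y f
  exact (coy_app φ f).trans ((congrArg _ h).trans (coy_app ψ f).symm)

variable (k C) in
/-- Finite direct sums of representable functors. -/
def IsFree : ObjectProperty (C ⥤ ModuleCat.{u} k) :=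
  fun P => ∃ (n : ℕ) (X : Fin n → C), Nonempty (P ≅ ⨁ fun j => coy k (X j))

theorem IsFree.of_fintype {ι : Type} [Finite ι] (X : ι → C) :
    IsFree k C (⨁ fun j => coy k (X j)) := by
  obtain ⟨n, ⟨e⟩⟩ := Finite.exists_equiv_fin ι
  exact ⟨n, X ∘ e.symm, ⟨(biproduct.whiskerEquiv e.symm fun _ => Iso.refl _).symm⟩⟩

theorem IsFree.of_iso {P Q : C ⥤ ModuleCat.{u} k} (e : P ≅ Q) (h : IsFree k C P) :
    IsFree k C Q := by
  obtain ⟨n, X, ⟨f⟩⟩ := h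
  exact ⟨n, X, ⟨e.symm ≪≫ f⟩⟩

theorem IsFree.of_isZero {P : C ⥤ ModuleCat.{u} k} (h : IsZero P) : IsFree k C P := by
  refine ⟨0, Fin.elim0, ⟨h.iso ?_⟩⟩
  rw [IsZero.iff_id_eq_zero]
  exact biproduct.hom_ext _ _ fun j => j.elim0

theorem IsFree.biprod {P Q : C ⥤ ModuleCat.{u} k} (hP : IsFree k C P) (hQ : IsFree k C Q) :
    IsFree k C (P ⊞ Q) := by
  obtain ⟨m, X, ⟨e⟩⟩ := hP
  obtain ⟨n, Y, ⟨f⟩⟩ := hQ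
  let p : ∀ j, P ⊞ Q ⟶ coy k (Sum.elim X Y j) := fun j => match j with
    | .inl j => biprod.fst ≫ e.hom ≫ biproduct.π _ j
    | .inr j => biprod.snd ≫ f.hom ≫ biproduct.π _ j
  have he := (mono_iff_app e.hom).1 inferInstance
  have he' := (epi_iff_app e.hom).1 inferInstance
  have hf := (mono_iff_app f.hom).1 inferInstance
  have hf' := (epi_iff_app f.hom).1 inferInstance
  obtain ⟨g⟩ := nonempty_iso_biproduct p fun Z => by
    constructor
    · intro x y h
      refine (biprod_bijective P Q Z).1 (Prod.ext (he Z ?_) (hf Z ?_))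
      · exact (biproduct_bijective _ Z).1 (funext fun j => congrFun h (.inl j))
      · exact (biproduct_bijective _ Z).1 (funext fun j => congrFun h (.inr j))
    · intro c
      obtain ⟨a, ha⟩ := (biproduct_bijective _ Z).2 fun j => c (.inl j)
      obtain ⟨b, hb⟩ := (biproduct_bijective _ Z).2 fun j => c (.inr j)
      obtain ⟨a, rfl⟩ := he' Z a
      obtain ⟨b, rfl⟩ := hf' Z b
      obtain ⟨x, hx⟩ := (biprod_bijective P Q Z).2 (a, b)
      obtain ⟨rfl, rfl⟩ := Prod.ext_iff.1 hx
      refine ⟨x, funext fun j => ?_⟩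
      rcases j with j | j
      · exact congrFun ha j
      · exact congrFun hb j
  exact (IsFree.of_fintype (Sum.elim X Y)).of_iso g.symm

/-- By Yoneda it suffices to lift the images of the identities. Only linear functors `M` are
allowed, since an element of a nonlinear functor need not define a morphism from `coy k X`. -/
theorem IsFree.exists_lift {P M N : C ⥤ ModuleCat.{u} k} (hP : IsFree k C P) (hM : IsLin k C M)
    (q : M ⟶ N) (hq : ∀ X, Function.Surjective (q.app X)) (f : P ⟶ N) : ∃ g : P ⟶ M, g ≫ q = f := by
  obtain ⟨n, X, ⟨e⟩⟩ := hP
  choose m hm using fun j => hq (X j)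
    ((biproduct.ι (fun j => coy k (X j)) j ≫ e.inv ≫ f).app (X j) (𝟙 (X j)))
  refine ⟨e.hom ≫ biproduct.desc fun j => yonedaMap hM (m j), ?_⟩
  rw [← cancel_epi e.inv, Category.assoc, Iso.inv_hom_id_assoc]
  refine biproduct.hom_ext' _ _ fun j => ?_
  rw [biproduct.ι_desc_assoc]
  refine coy_hom_ext ?_
  rw [← hm j]
  have : (yonedaMap hM (m j) ≫ q).app (X j) (𝟙 (X j)) = q.app (X j) (M.map (𝟙 (X j)) (m j)) := rfl
  rw [this, M.map_id]
  rfl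

theorem isLin_pi {ι : Type*} {F : ι → (C ⥤ ModuleCat.{u} k)} {L : C ⥤ ModuleCat.{u} k}
    (p : ∀ j, L ⟶ F j) (hp : ∀ X, Function.Injective fun (x : L.obj X) j => (p j).app X x)
    (h : ∀ j, IsLin k C (F j)) : IsLin k C L := by
  refine IsLin.mk' (fun f g m => hp _ (funext fun j => ?_))
    (fun r f m => hp _ (funext fun j => ?_))
  · simp only [map_add, naturality_app, (h j).map_add]
  · simp only [map_smul, naturality_app, (h j).map_smul]

theorem IsFree.isLin {P : C ⥤ ModuleCat.{u} k} (hP : IsFree k C P) : IsLin k C P := by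
  obtain ⟨n, X, ⟨e⟩⟩ := hP
  have h : IsLin k C (⨁ fun j => coy k (X j)) :=
    isLin_pi _ (fun Y => (biproduct_bijective _ Y).1) fun j => isLin_coy (X j)
  exact h.of_injective e.hom ((mono_iff_app _).1 inferInstance)

end Free

/-! ### Finite resolutions and the horseshoe lemma -/

section Resolution

variable (k : Type u) [Field k] {C : Type u} [Category.{u} C] [Preadditive C] [Linear k C]

/-- `M` has a resolution of length at most `r` by finite direct sums of representable functors. -/
def HasRes : ℕ → ObjectProperty (C ⥤ ModuleCat.{u} k)
  | 0 => IsFree k C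
  | r + 1 => fun M => ∃ (K P : C ⥤ ModuleCat.{u} k) (i : K ⟶ P) (p : P ⟶ M), IsFree k C P ∧
      (∀ X, Function.Injective (i.app X)) ∧ (∀ X, Function.Exact (i.app X) (p.app X)) ∧
      (∀ X, Function.Surjective (p.app X)) ∧ HasRes r K

variable {k}

end Resolution

section Horseshoe

variable {k : Type u} [Field k] {C : Type u} [Category.{u} C]

theorem biprod_desc_app {M N L : C ⥤ ModuleCat.{u} k} (f : M ⟶ L) (g : N ⟶ L) {X : C}
    (x : (M ⊞ N).obj X) : (biprod.desc f g).app X x =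
      f.app X ((biprod.fst : M ⊞ N ⟶ M).app X x) + g.app X ((biprod.snd : M ⊞ N ⟶ N).app X x) := by
  rw [biprod.desc_eq]
  rfl

theorem exists_lift_of_exact {K P M L : C ⥤ ModuleCat.{u} k} {i : K ⟶ P} {p : P ⟶ M}
    (hi : ∀ X, Function.Injective (i.app X)) (hip : ∀ X, Function.Exact (i.app X) (p.app X))
    (f : L ⟶ P) (hf : f ≫ p = 0) : ∃ g : L ⟶ K, g ≫ i = f := by
  obtain ⟨w, h⟩ := (exactAt_iff_app i p).2 hip
  have : Mono (ShortComplex.mk i p w).f := (mono_iff_app i).2 hi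
  exact ⟨h.lift f hf, h.lift_f f hf⟩

theorem kernel_injective {M N : C ⥤ ModuleCat.{u} k} (f : M ⟶ N) (X : C) :
    Function.Injective ((kernel.ι f).app X) :=
  (mono_iff_app _).1 inferInstance X

theorem kernel_exact {M N : C ⥤ ModuleCat.{u} k} (f : M ⟶ N) (X : C) :
    Function.Exact ((kernel.ι f).app X) (f.app X) :=
  (exactAt_iff_app _ _).1 (exactAt_of_isLimit (kernelIsKernel f)) X

theorem cokernel_surjective {M N : C ⥤ ModuleCat.{u} k} (f : M ⟶ N) (X : C) :
    Function.Surjective ((cokernel.π f).app X) :=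
  (epi_iff_app _).1 inferInstance X

theorem cokernel_exact {M N : C ⥤ ModuleCat.{u} k} (f : M ⟶ N) (X : C) :
    Function.Exact (f.app X) ((cokernel.π f).app X) :=
  (exactAt_iff_app _ _).1 (exactAt_of_isColimit (cokernelIsCokernel f)) X

variable [Preadditive C] [Linear k C]

/-- The horseshoe lemma without loss of length: covers of the two ends combine to a cover of `M`,
and the kernels again form a short exact sequence. -/
theorem HasRes.extension {r : ℕ} {M' M M'' : C ⥤ ModuleCat.{u} k} (i : M' ⟶ M) (q : M ⟶ M'')
    (hM : IsLin k C M) (hi : ∀ X, Function.Injective (i.app X))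
    (hiq : ∀ X, Function.Exact (i.app X) (q.app X)) (hq : ∀ X, Function.Surjective (q.app X))
    (h' : HasRes k r M') (h'' : HasRes k r M'') : HasRes k r M := by
  induction r generalizing M' M M'' with
  | zero =>
    -- The quotient is free, so the sequence splits.
    obtain ⟨s, hs⟩ := IsFree.exists_lift h'' hM q hq (𝟙 M'')
    have hs' : ∀ {X : C} (x : M''.obj X), q.app X (s.app X x) = x := fun {X} x =>
      congrArg (fun f : M'' ⟶ M'' => (f.app X).hom x) hs
    obtain ⟨e⟩ := nonempty_iso_of_bijective (biprod.desc i s) fun X => by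
      constructor
      · rw [injective_iff_map_eq_zero]
        intro x hx
        rw [biprod_desc_app] at hx
        have h2 := congrArg (q.app X) hx
        rw [map_add, (hiq X).apply_apply_eq_zero, zero_add, hs', map_zero] at h2
        rw [h2, map_zero, add_zero] at hx
        have h1 := hi X (hx.trans (map_zero _).symm)
        exact (biprod_bijective M' M'' X).1 (Prod.ext (h1.trans (map_zero _).symm)
          (h2.trans (map_zero _).symm))
      · intro m
        obtain ⟨a, ha⟩ := (hiq X (m - s.app X (q.app X m))).1 (by rw [map_sub, hs', sub_self])
        obtain ⟨x, hx⟩ := (biprod_bijective M' M'' X).2 (a, q.app X m)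
        obtain ⟨h1, h2⟩ := Prod.ext_iff.1 hx
        dsimp only at h1 h2
        exact ⟨x, by rw [biprod_desc_app, h1, h2, ha, sub_add_cancel]⟩
    exact (IsFree.biprod h' h'').of_iso e
  | succ r ih =>
    obtain ⟨K', P', i', p', hP', hi', hip', hp', hK'⟩ := h'
    obtain ⟨K'', P'', i'', p'', hP'', hi'', hip'', hp'', hK''⟩ := h''
    obtain ⟨g, hg⟩ := IsFree.exists_lift hP'' hM q hq p''
    have hg' : ∀ {X : C} (x : P''.obj X), q.app X (g.app X x) = p''.app X x := fun {X} x =>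
      congrArg (fun f : P'' ⟶ M'' => (f.app X).hom x) hg
    let Φ : P' ⊞ P'' ⟶ M := biprod.desc (p' ≫ i) g
    have hΦ : ∀ {X : C} (x : (P' ⊞ P'').obj X), Φ.app X x =
        i.app X (p'.app X ((biprod.fst : P' ⊞ P'' ⟶ P').app X x)) +
          g.app X ((biprod.snd : P' ⊞ P'' ⟶ P'').app X x) := fun x => biprod_desc_app _ _ x
    have hqΦ : ∀ {X : C} (x : (P' ⊞ P'').obj X), q.app X (Φ.app X x) =
        p''.app X ((biprod.snd : P' ⊞ P'' ⟶ P'').app X x) := fun {X} x => by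
      rw [hΦ, map_add, (hiq X).apply_apply_eq_zero, zero_add, hg']
    have hΦs : ∀ X, Function.Surjective (Φ.app X) := by
      intro X m
      obtain ⟨b, hb⟩ := hp'' X (q.app X m)
      obtain ⟨m', hm'⟩ := (hiq X (m - g.app X b)).1 (by rw [map_sub, hg', hb, sub_self])
      obtain ⟨a, rfl⟩ := hp' X m'
      obtain ⟨x, hx⟩ := (biprod_bijective P' P'' X).2 (a, b)
      obtain ⟨h1, h2⟩ := Prod.ext_iff.1 hx
      dsimp only at h1 h2
      exact ⟨x, by rw [hΦ, h1, h2, hm', sub_add_cancel]⟩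
    have hP := hP'.biprod hP''
    refine ⟨kernel Φ, P' ⊞ P'', kernel.ι Φ, Φ, hP, kernel_injective Φ, kernel_exact Φ, hΦs, ?_⟩
    obtain ⟨j, hj⟩ := exists_lift_of_exact (kernel_injective Φ) (kernel_exact Φ)
      (i' ≫ (biprod.inl : P' ⟶ P' ⊞ P'')) (by
        obtain ⟨w, -⟩ := (exactAt_iff_app i' p').2 hip'
        simp [Φ, reassoc_of% w])
    obtain ⟨t, ht⟩ := exists_lift_of_exact hi'' hip'' (kernel.ι Φ ≫ biprod.snd) (by
      ext X x
      exact (hqΦ ((kernel.ι Φ).app X x)).symm.trans (by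
        rw [(kernel_exact Φ X).apply_apply_eq_zero, map_zero]; rfl))
    have hj1 : j ≫ kernel.ι Φ ≫ biprod.fst = i' := by rw [reassoc_of% hj]; simp
    have hj2 : j ≫ kernel.ι Φ ≫ biprod.snd = 0 := by rw [reassoc_of% hj]; simp
    have hj1' : ∀ {X : C} (x : K'.obj X), (biprod.fst : P' ⊞ P'' ⟶ P').app X
        ((kernel.ι Φ).app X (j.app X x)) = i'.app X x := fun {X} x =>
      congrArg (fun f : K' ⟶ P' => (f.app X).hom x) hj1
    have hj2' : ∀ {X : C} (x : K'.obj X), (biprod.snd : P' ⊞ P'' ⟶ P'').app X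
        ((kernel.ι Φ).app X (j.app X x)) = 0 := fun {X} x =>
      congrArg (fun f : K' ⟶ P'' => (f.app X).hom x) hj2
    have ht' : ∀ {X : C} (x : (kernel Φ).obj X), i''.app X (t.app X x) =
        (biprod.snd : P' ⊞ P'' ⟶ P'').app X ((kernel.ι Φ).app X x) := fun {X} x =>
      congrArg (fun f : kernel Φ ⟶ P'' => (f.app X).hom x) ht
    -- The sequence of syzygies `K' → kernel Φ → K''` is checked to be short exact.
    refine ih j t (hP.isLin.of_injective _ (kernel_injective Φ)) ?_ ?_ ?_ hK' hK''
    · intro X x y h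
      apply hi' X
      rw [← hj1' x, ← hj1' y, h]
    · intro X x
      constructor
      · intro hx
        have h2 := ht' x
        rw [hx, map_zero] at h2
        have h3 := (kernel_exact Φ X).apply_apply_eq_zero x
        rw [hΦ, ← h2, map_zero, add_zero] at h3
        obtain ⟨y, hy⟩ := (hip' X _).1 (hi X (h3.trans (map_zero _).symm))
        refine ⟨y, kernel_injective Φ X ((biprod_bijective P' P'' X).1 (Prod.ext ?_ ?_))⟩
        · exact (hj1' y).trans hy
        · exact (hj2' y).trans h2
      · rintro ⟨y, rfl⟩
        apply hi'' X
        rw [ht', hj2', map_zero]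
    · intro X y
      have hy := (hip'' X).apply_apply_eq_zero y
      rw [← hg'] at hy
      obtain ⟨m', hm'⟩ := (hiq X _).1 hy
      obtain ⟨a, rfl⟩ := hp' X m'
      -- The sign makes the two components of `Φ` cancel, because `i (p' a) = g (i'' y)`.
      obtain ⟨x, hx⟩ := (biprod_bijective P' P'' X).2 (-a, i''.app X y)
      obtain ⟨h1, h2⟩ := Prod.ext_iff.1 hx
      dsimp only at h1 h2
      obtain ⟨z, hz⟩ := (kernel_exact Φ X x).1 (by
        rw [hΦ, h1, h2, map_neg, map_neg, hm', neg_add_cancel])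
      exact ⟨z, hi'' X (by rw [ht', hz, h2])⟩

end Horseshoe

/-! ### Finite resolutions of tame functors -/

section Pure

variable (k : Type u) [Field k] {C : Type u} [Category.{u} C] [Preadditive C] [Linear k C]

/-- The conditions satisfied by the arrow system of a graded quadratic monomial category. -/
structure ArrowSystem.IsMonomial (A : ArrowSystem C) : Prop where
  finite_deg : ∀ n, {X | A.deg X = n}.Finite
  hom_eq_zero : ∀ {X Y : C} (f : X ⟶ Y), A.deg Y ≤ A.deg X → X ≠ Y → f = 0
  end_scalar : ∀ {X : C} (f : X ⟶ X), ∃ c : k, f = c • 𝟙 X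
  finite_hom : ∀ X Y : C, Module.Finite k (X ⟶ Y)
  tame_coy : ∀ X : C, Tame A (coy k X) (A.deg X)
  bounded_rk : ∃ N, ∀ (Y : C) (γ : A.In Y), A.rk γ < N

variable {k} {A : ArrowSystem C}

theorem biproduct_desc_yonedaMap {M : C ⥤ ModuleCat.{u} k} (hM : IsLin k C M) {ι : Type}
    [Fintype ι] (X : ι → C) (e : ∀ j, M.obj (X j)) {Y : C}
    (x : (⨁ fun j => coy k (X j)).obj Y) :
    (biproduct.desc fun j => yonedaMap hM (e j)).app Y x =
      ∑ j, M.map ((biproduct.π (fun j => coy k (X j)) j).app Y x : X j ⟶ Y) (e j) := by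
  conv_lhs => rw [biproduct_eq_sum _ x, map_sum]
  refine Finset.sum_congr rfl fun j _ => ?_
  exact congrArg (fun f : coy k (X j) ⟶ M => (f.app Y).hom _)
    (biproduct.ι_desc (fun j => yonedaMap hM (e j)) j)

/-- Between objects of the same degree only scalar endomorphisms survive, so the sum reduces to the
expansion in the basis of `M.obj Y`. -/
theorem ArrowSystem.IsMonomial.bijective_sum_basis (hA : A.IsMonomial k) {M : C ⥤ ModuleCat.{u} k}
    (hM : IsLin k C M) {n : ℤ} [Fintype {X | A.deg X = n}] {κ : {X | A.deg X = n} → Type}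
    [∀ X, Fintype (κ X)] (B : ∀ X, Module.Basis (κ X) k (M.obj X.1)) {Y : C} (hY : A.deg Y = n) :
    Function.Bijective fun c : ∀ s : (Σ X, κ X), s.1.1 ⟶ Y => ∑ s, M.map (c s) (B s.1 s.2) := by
  classical
  have hsum : ∀ c : ∀ s : (Σ X, κ X), s.1.1 ⟶ Y, ∑ s, M.map (c s) (B s.1 s.2) =
      ∑ i, M.map (c ⟨⟨Y, hY⟩, i⟩) (B ⟨Y, hY⟩ i) := by
    intro c
    rw [Fintype.sum_sigma]
    refine Finset.sum_eq_single_of_mem _ (Finset.mem_univ _) fun Z _ hZ =>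
      Finset.sum_eq_zero fun i _ => ?_
    rw [hA.hom_eq_zero (c ⟨Z, i⟩) (hY.trans Z.2.symm).le fun h => hZ (Subtype.ext h), hM.map_zero]
  constructor
  · intro c d hcd
    dsimp only at hcd
    rw [hsum, hsum, ← sub_eq_zero, ← Finset.sum_sub_distrib] at hcd
    choose a ha using fun i => hA.end_scalar (c ⟨⟨Y, hY⟩, i⟩)
    choose b hb using fun i => hA.end_scalar (d ⟨⟨Y, hY⟩, i⟩)
    have h0 : ∑ i, (a i - b i) • B ⟨Y, hY⟩ i = 0 := by
      rw [← hcd]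
      refine Finset.sum_congr rfl fun i _ => ?_
      rw [ha, hb, hM.map_smul, hM.map_smul, M.map_id, sub_smul]
      rfl
    have h1 := Fintype.linearIndependent_iff.1 (B ⟨Y, hY⟩).linearIndependent _ h0
    funext ⟨⟨Z, hZ⟩, i⟩
    by_cases h : Z = Y
    · subst h
      rw [ha, hb, sub_eq_zero.1 (h1 i)]
    · rw [hA.hom_eq_zero (c _) (hY.trans hZ.symm).le h, hA.hom_eq_zero (d _) (hY.trans hZ.symm).le h]
  · intro m
    refine ⟨fun s => if h : s.1.1 = Y then
      (B s.1).repr (M.map (eqToHom h.symm) m) s.2 • eqToHom h else 0, ?_⟩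
    dsimp only
    rw [hsum]
    simp only [dif_pos, eqToHom_refl, M.map_id, hM.map_smul]
    exact (B ⟨Y, hY⟩).sum_repr m

theorem ArrowSystem.IsMonomial.exists_cover (hA : A.IsMonomial k) {M : C ⥤ ModuleCat.{u} k}
    (hM : IsLin k C M) (hfin : ∀ X, Module.Finite k (M.obj X)) (n : ℤ) :
    ∃ (r : ℕ) (X : Fin r → C) (p : (⨁ fun j => coy k (X j)) ⟶ M),
      (∀ j, A.deg (X j) = n) ∧ ∀ Y, A.deg Y = n → Function.Bijective (p.app Y) := by
  have := (hA.finite_deg n).to_subtype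
  have := Fintype.ofFinite {X | A.deg X = n}
  obtain ⟨r, ⟨ε⟩⟩ := Finite.exists_equiv_fin
    (Σ X : {X | A.deg X = n}, Fin (Module.finrank k (M.obj X.1)))
  let B : ∀ X : {X | A.deg X = n}, Module.Basis _ k (M.obj X.1) :=
    fun X => Module.finBasis k (M.obj X.1)
  refine ⟨r, fun j => (ε.symm j).1.1, biproduct.desc fun j =>
    yonedaMap hM (B (ε.symm j).1 (ε.symm j).2), fun j => (ε.symm j).1.2, fun Y hY => ?_⟩
  convert ((hA.bijective_sum_basis hM B hY).comp
    (Equiv.piCongrLeft (fun s => s.1.1 ⟶ Y) ε.symm).bijective).comp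
    (biproduct_bijective (fun j => coy k (ε.symm j).1.1) Y) using 1
  funext x
  rw [biproduct_desc_yonedaMap]
  dsimp only [Function.comp]
  rw [← ε.symm.sum_comp]
  refine Finset.sum_congr rfl fun j _ => ?_
  exact congrArg (fun f : (ε.symm j).1.1 ⟶ Y => (M.map f).hom (B (ε.symm j).1 (ε.symm j).2))
    (Equiv.piCongrLeft_apply_apply (fun s => s.1.1 ⟶ Y) ε.symm
      (fun j => (biproduct.π (fun j => coy k (ε.symm j).1.1) j).app Y x) j).symm

theorem ArrowSystem.IsMonomial.coy_subsingleton (hA : A.IsMonomial k) {X Y : C}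
    (h : A.deg Y < A.deg X) : Subsingleton ((coy k X).obj Y) :=
  subsingleton_of_forall_eq (0 : X ⟶ Y) fun f => hA.hom_eq_zero f h.le fun e =>
    h.ne (congrArg A.deg e).symm

/-- A tame functor starting in degree `n` is generated there, so the free functor on bases of its
values in degree `n` maps onto it, bijectively in degrees at most `n`. -/
theorem ArrowSystem.IsMonomial.exists_pure_cover (hA : A.IsMonomial k) {M : C ⥤ ModuleCat.{u} k}
    {n : ℤ} (hM : IsLin k C M) (hfin : ∀ X, Module.Finite k (M.obj X))
    (h0 : ∀ X, A.deg X < n → Subsingleton (M.obj X)) (tM : Tame A M n) :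
    ∃ (P : C ⥤ ModuleCat.{u} k) (p : P ⟶ M), IsFree k C P ∧ Tame A P n ∧
      (∀ X, Module.Finite k (P.obj X)) ∧ (∀ X, Function.Surjective (p.app X)) ∧
      ∀ X, A.deg X ≤ n → Function.Injective (p.app X) := by
  obtain ⟨r, X, p, hX, hp⟩ := hA.exists_cover hM hfin n
  have hb := biproduct_bijective (fun j => coy k (X j))
  refine ⟨_, p, IsFree.of_fintype X, ?_, ?_, ?_, ?_⟩
  · exact Tame.pi _ hb fun j => (hA.tame_coy (X j)).mono (hX j).le
  · intro Y
    have := fun j => hA.finite_hom (X j) Y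
    let f : (⨁ fun j => coy k (X j)).obj Y →ₗ[k] (∀ j, X j ⟶ Y) :=
      LinearMap.pi fun j => ((biproduct.π (fun j => coy k (X j)) j).app Y).hom
    exact Module.Finite.of_injective f (hb Y).1
  · refine surjective_of_tame tM p fun Y hY => ?_
    rcases hY.lt_or_eq with hY | hY
    · exact fun y => ⟨0, (h0 Y hY).elim _ _⟩
    · exact (hp Y hY).2
  · intro Y hY
    rcases hY.lt_or_eq with hY | hY
    · intro x y _
      refine (hb Y).1 (funext fun j => ?_)
      exact (hA.coy_subsingleton (hY.trans_eq (hX j).symm)).elim _ _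
    · exact (hp Y hY).1

/-- Induction on the rank threshold. The cover is bijective in degree `n`, so its kernel starts in
degree `n + 1`. A forbidden composite strictly raises the rank of the earlier arrow, which lowers
the threshold for the kernel by one. -/
theorem hasRes_of_pure (hA : A.IsMonomial k) (r : ℕ) {M : C ⥤ ModuleCat.{u} k} {n : ℤ}
    (hM : IsLin k C M) (hfin : ∀ X, Module.Finite k (M.obj X))
    (h0 : ∀ X, A.deg X < n → Subsingleton (M.obj X)) (tM : Tame A M n)
    (hr : ∀ (Y : C) (γ : A.In Y), A.deg (A.src γ) = n → r ≤ A.rk γ →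
      Function.Injective (A.act M γ)) : HasRes k r M := by
  induction r generalizing M n with
  | zero =>
    obtain ⟨P, p, hP, tP, hPf, hs, hi⟩ := hA.exists_pure_cover hM hfin h0 tM
    have tK := Tame.kernel (kernel.ι p) p hP.isLin (kernel_injective p) (kernel_exact p) tP tM
    have hK : ∀ X, Subsingleton ((kernel p).obj X) := by
      refine subsingleton_of_tame tK fun X hX => subsingleton_of_forall_eq 0 fun x => ?_
      apply kernel_injective p X
      rw [map_zero]
      have hx := (kernel_exact p X).apply_apply_eq_zero x
      by_cases hXn : A.deg X ≤ n
      · exact hi X hXn (hx.trans (map_zero _).symm)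
      obtain ⟨c, hc⟩ := tP.span X (by omega) ((kernel.ι p).app X x)
      rw [hc, A.app_sum_act] at hx
      rw [hc]
      refine Finset.sum_eq_zero fun δ _ => ?_
      have hδ := A.deg_src δ
      -- For `r = 0` all arrows are injective on degree `n`, so a kernel element of degree `n + 1`
      -- has zero components; tameness then makes the whole kernel vanish.
      have h1 := hr X δ (by omega) (Nat.zero_le _)
        ((tM.indep X (by omega) _ hx δ).trans (map_zero _).symm)
      rw [hi _ (by omega) (h1.trans (map_zero _).symm), map_zero]
    obtain ⟨e⟩ := nonempty_iso_of_bijective p fun X => ⟨by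
      rw [injective_iff_map_eq_zero]
      intro x hx
      obtain ⟨y, rfl⟩ := (kernel_exact p X x).1 hx
      rw [(hK X).elim y 0, map_zero], hs X⟩
    exact hP.of_iso e
  | succ r ih =>
    obtain ⟨P, p, hP, tP, hPf, hs, hi⟩ := hA.exists_pure_cover hM hfin h0 tM
    refine ⟨kernel p, P, kernel.ι p, p, hP, kernel_injective p, kernel_exact p, hs, ?_⟩
    refine ih (n := n + 1) (hP.isLin.of_injective _ (kernel_injective p)) ?_ ?_ ?_ ?_
    · intro X
      have := hPf X
      exact Module.Finite.of_injective ((kernel.ι p).app X).hom (kernel_injective p X)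
    · intro X hX
      refine subsingleton_of_forall_eq 0 fun x => kernel_injective p X ?_
      rw [map_zero]
      exact hi X (by omega) (((kernel_exact p X).apply_apply_eq_zero x).trans (map_zero _).symm)
    · exact Tame.kernel (kernel.ι p) p hP.isLin (kernel_injective p) (kernel_exact p) tP tM
    · intro Y γ hγ hrγ
      rw [injective_iff_map_eq_zero]
      intro x hx
      apply kernel_injective p
      rw [map_zero]
      replace hx := congrArg ((kernel.ι p).app Y) hx
      rw [A.app_act, map_zero] at hx
      have hpx := (kernel_exact p _).apply_apply_eq_zero x
      obtain ⟨c, hc⟩ := tP.span _ (by omega) ((kernel.ι p).app _ x)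
      rw [hc] at hpx hx ⊢
      -- The legal part of `x` vanishes since `γ` is injective on it in `P`.
      obtain ⟨c', hc0, hc1, hc'⟩ := exists_legal hP.isLin γ c
      rw [hc'] at hx
      have h1 := tP.inj Y γ (by omega) c' hc0 hx
      rw [A.app_sum_act] at hpx
      refine Finset.sum_eq_zero fun δ _ => ?_
      by_cases hδ : A.legal γ δ
      · rw [← hc1 δ hδ]
        exact tP.indep _ (by omega) c' h1 δ
      -- A forbidden `δ` satisfies `r + 1 ≤ rk δ`, hence is injective on degree `n` of `M`. As `δ (p
      -- c_δ) = 0` by independence, also `c_δ = 0`.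
      · have hd := A.deg_src δ
        have hrk := A.rk_lt γ δ hδ
        have h2 := hr _ δ (by omega) (by omega)
          ((tM.indep _ (by omega) _ hpx δ).trans (map_zero _).symm)
        rw [hi _ (by omega) (h2.trans (map_zero _).symm), map_zero]

/-- The subfunctor of `M` given by a family of submodules. -/
def subfunctor (M : C ⥤ ModuleCat.{u} k) (S : ∀ X, Submodule k (M.obj X))
    (hS : ∀ {X Y : C} (f : X ⟶ Y), S X ≤ (S Y).comap (M.map f).hom) : C ⥤ ModuleCat.{u} k where
  obj X := ModuleCat.of k (S X)
  map f := ModuleCat.ofHom ((M.map f).hom.restrict (hS f))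

/-- The inclusion of a subfunctor. -/
def subfunctor.ι (M : C ⥤ ModuleCat.{u} k) (S : ∀ X, Submodule k (M.obj X))
    (hS : ∀ {X Y : C} (f : X ⟶ Y), S X ≤ (S Y).comap (M.map f).hom) : subfunctor M S hS ⟶ M where
  app X := ModuleCat.ofHom (S X).subtype

/-- The part in degrees above `a` is a subfunctor because no nonzero morphism lowers the degree. -/
theorem exists_truncation (hA : A.IsMonomial k) {M : C ⥤ ModuleCat.{u} k} (hM : IsLin k C M)
    (a : ℤ) : ∃ (M' : C ⥤ ModuleCat.{u} k) (i : M' ⟶ M), (∀ X, Function.Injective (i.app X)) ∧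
      (∀ X, A.deg X ≤ a → Subsingleton (M'.obj X)) ∧
      ∀ X, a < A.deg X → Function.Surjective (i.app X) := by
  classical
  let S : ∀ X, Submodule k (M.obj X) := fun X => if a < A.deg X then ⊤ else ⊥
  have hS : ∀ {X Y : C} (f : X ⟶ Y), S X ≤ (S Y).comap (M.map f).hom := by
    intro X Y f x hx
    by_cases hX : a < A.deg X
    · by_cases hY : a < A.deg Y
      · simp [S, hY]
      · have : f = 0 := hA.hom_eq_zero f (by omega) (by rintro rfl; exact hY hX)
        rw [this, Submodule.mem_comap]
        have h : (M.map (0 : X ⟶ Y)).hom x = 0 := hM.map_zero x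
        rw [h]
        exact zero_mem _
    · simp only [S, if_neg hX, Submodule.mem_bot] at hx
      rw [hx]
      exact zero_mem _
  refine ⟨subfunctor M S hS, subfunctor.ι M S hS, fun X => Subtype.val_injective, ?_, ?_⟩
  · intro X hX
    have : S X = ⊥ := if_neg (by omega)
    change Subsingleton (S X)
    rw [this]
    infer_instance
  · intro X hX m
    have : S X = ⊤ := if_pos hX
    exact ⟨⟨m, this ▸ Submodule.mem_top⟩, rfl⟩

/-- The degrees between the lowest one `a` and the tameness bound `n` are peeled off successively.
Every piece has a resolution of the same length `N`, the bound on the rank, so the horseshoe lemma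
applies at each stage. -/
theorem exists_hasRes (hA : A.IsMonomial k) {M : C ⥤ ModuleCat.{u} k} {a n : ℤ}
    (hM : IsLin k C M) (hfin : ∀ X, Module.Finite k (M.obj X))
    (h0 : ∀ X, A.deg X < a → Subsingleton (M.obj X)) (tM : Tame A M n) :
    ∃ r, HasRes k r M := by
  obtain ⟨N, hN⟩ := hA.bounded_rk
  refine ⟨N, ?_⟩
  obtain ⟨d, hd⟩ : ∃ d : ℕ, n ≤ a + d := ⟨(n - a).toNat, by omega⟩
  induction d generalizing M a with
  | zero =>
    exact hasRes_of_pure hA N hM hfin h0 (tM.mono (by simpa using hd))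
      fun Y γ _ h => absurd (hN Y γ) (by omega)
  | succ d ih =>
    by_cases hna : n ≤ a
    · exact hasRes_of_pure hA N hM hfin h0 (tM.mono hna)
        fun Y γ _ h => absurd (hN Y γ) (by omega)
    obtain ⟨M', i, hi, hi0, his⟩ := exists_truncation hA hM a
    have hq : ∀ X, a < A.deg X → Subsingleton ((cokernel i).obj X) := by
      intro X hX
      refine subsingleton_of_forall_eq 0 fun y => ?_
      obtain ⟨m, rfl⟩ := cokernel_surjective i X y
      obtain ⟨m', rfl⟩ := his X hX m
      exact (cokernel_exact i X).apply_apply_eq_zero m'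
    refine HasRes.extension i (cokernel.π i) hM hi (cokernel_exact i) (cokernel_surjective i) ?_ ?_
    · refine ih (a := a + 1) (hM.of_injective i hi) ?_ (fun X hX => hi0 X (by omega)) ?_ ?_
      · intro X
        have := hfin X
        exact Module.Finite.of_injective (i.app X).hom (hi X)
      · exact
        { span := fun Y hY m => by
            obtain ⟨c, hc⟩ := tM.span Y hY (i.app Y m)
            choose b hb using fun γ : A.In Y =>
              his (A.src γ) (by have := A.deg_src γ; omega) (c γ)
            refine ⟨b, hi Y ?_⟩
            rw [hc, A.app_sum_act]
            simp only [hb]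
          indep := fun Y hY c hc γ => by
            apply hi Y
            rw [A.app_act, map_zero]
            refine tM.indep Y hY (fun γ => i.app _ (c γ)) ?_ γ
            rw [← A.app_sum_act, hc, map_zero]
          inj := fun Y γ hY c hc h => by
            apply hi _
            rw [A.app_sum_act, map_zero]
            refine tM.inj Y γ hY (fun δ => i.app _ (c δ))
              (fun δ hδ => by rw [hc δ hδ, map_zero]) ?_
            rw [← A.app_sum_act, ← A.app_act, h, map_zero] }
      · push_cast at hd
        omega
    -- The quotient is concentrated in degree `a`, hence vacuously tame above `a`.
    · refine hasRes_of_pure hA N (n := a) (hM.of_surjective _ (cokernel_surjective i)) ?_ ?_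
        (Tame.of_subsingleton hq) fun Y γ _ h => absurd (hN Y γ) (by omega)
      · intro X
        have := hfin X
        exact Module.Finite.of_surjective ((cokernel.π i).app X).hom (cokernel_surjective i X)
      · intro X hX
        refine subsingleton_of_forall_eq 0 fun y => ?_
        obtain ⟨m, rfl⟩ := cokernel_surjective i X y
        rw [(h0 X hX).elim m 0, map_zero]

end Pure

/-! ### Perfect, finitely presented and tame functors coincide -/

section Perfect

variable (k : Type u) [Field k] (C : Type u) [Category.{u} C] [Preadditive C] [Linear k C]

/-- Cokernels of morphisms between finite direct sums of representable functors. -/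
def IsFinPres : ObjectProperty (C ⥤ ModuleCat.{u} k) := fun M =>
  IsLin k C M ∧ ∃ (P₁ P₀ : C ⥤ ModuleCat.{u} k) (d : P₁ ⟶ P₀) (ε : P₀ ⟶ M),
    IsFree k C P₁ ∧ IsFree k C P₀ ∧ ExactAt d ε ∧ Epi ε

/-- Functors with a finite resolution by finite direct sums of representable functors. -/
def IsPerf : ObjectProperty (C ⥤ ModuleCat.{u} k) := fun M =>
  IsLin k C M ∧ ∃ (n : ℕ) (P : ℕ → (C ⥤ ModuleCat.{u} k)) (d : ∀ i, P (i + 1) ⟶ P i)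
    (ε : P 0 ⟶ M),
    (∀ i, IsFree k C (P i)) ∧ (∀ i, n < i → IsZero (P i)) ∧
    Epi ε ∧ ExactAt (d 0) ε ∧ ∀ i, ExactAt (d (i + 1)) (d i)

/-- Linear functors of finite total dimension. -/
def IsFinTotal : ObjectProperty (C ⥤ ModuleCat.{u} k) := fun M =>
  IsLin k C M ∧ (∀ X, Module.Finite k (M.obj X)) ∧ {X | Nontrivial (M.obj X)}.Finite

variable {k C}

theorem isFinPres_of_isPerf : IsPerf k C ≤ IsFinPres k C := by
  rintro M ⟨hM, n, P, d, ε, hP, -, hε, h, -⟩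
  exact ⟨hM, P 1, P 0, d 0, ε, hP 1, hP 0, h, hε⟩

theorem HasRes.isPerf {r : ℕ} {M : C ⥤ ModuleCat.{u} k} (hM : IsLin k C M) (h : HasRes k r M) :
    IsPerf k C M := by
  refine ⟨hM, ?_⟩
  induction r generalizing M with
  | zero =>
    obtain ⟨Z, hZ⟩ := HasZeroObject.zero (C := C ⥤ ModuleCat.{u} k)
    have hZ' := isZero_iff_app.1 hZ
    refine ⟨0, fun i => i.casesOn M fun _ => Z, fun _ => 0, 𝟙 M, ?_, ?_, inferInstance, ?_, ?_⟩
    · rintro (_ | i)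
      · exact h
      · exact IsFree.of_isZero hZ
    · rintro (_ | i) hi
      · exact absurd hi (lt_irrefl 0)
      · exact hZ
    · rw [exactAt_iff_app]
      intro X m
      exact ⟨fun hm => ⟨0, hm.symm⟩, fun ⟨z, hz⟩ => hz ▸ rfl⟩
    · intro i
      rw [exactAt_iff_app]
      intro X m
      exact ⟨fun _ => ⟨0, (hZ' X).elim _ _⟩, fun _ => rfl⟩
  | succ r ih =>
    obtain ⟨K, P, i, p, hP, hi, hip, hp, hK⟩ := h
    obtain ⟨n, Q, d, ε, hQ, hn, hε, h0, hd⟩ := ih (hP.isLin.of_injective i hi) hK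
    have hε' := (epi_iff_app ε).1 hε
    rw [exactAt_iff_app] at h0
    -- The resolution of `K` is spliced to `P` along `ε ≫ i`.
    let d' : ∀ j : ℕ, (Nat.casesOn (j + 1) P Q : C ⥤ ModuleCat.{u} k) ⟶ Nat.casesOn j P Q :=
      fun j => match j with
        | 0 => ε ≫ i
        | j + 1 => d j
    refine ⟨n + 1, fun j => j.casesOn P Q, d', p, ?_, ?_, (epi_iff_app p).2 hp, ?_, ?_⟩
    · rintro (_ | j)
      · exact hP
      · exact hQ j
    · rintro (_ | j) hj
      · exact absurd hj (Nat.not_lt_zero _)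
      · exact hn j (Nat.lt_of_succ_lt_succ hj)
    · rw [exactAt_iff_app]
      intro X x
      rw [hip X x]
      constructor
      · rintro ⟨y, rfl⟩
        obtain ⟨z, rfl⟩ := hε' X y
        exact ⟨z, rfl⟩
      · rintro ⟨z, rfl⟩
        exact ⟨_, rfl⟩
    · rintro (_ | j)
      · rw [exactAt_iff_app]
        intro X x
        rw [← h0 X x]
        exact ⟨fun hx => hi X (hx.trans (map_zero _).symm),
          fun hx => (congrArg (i.app X) hx).trans (map_zero _)⟩
      · exact hd j

variable (k) in
/-- Linear functors that are locally finite-dimensional, vanish in low degrees and are tame in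
high degrees. -/
def IsTame (A : ArrowSystem C) : ObjectProperty (C ⥤ ModuleCat.{u} k) := fun M =>
  IsLin k C M ∧ (∀ X, Module.Finite k (M.obj X)) ∧
    ∃ n : ℤ, (∀ X, A.deg X < -n → Subsingleton (M.obj X)) ∧ Tame A M n

variable {A : ArrowSystem C}

theorem isPerf_of_isTame (hA : A.IsMonomial k) : IsTame k A ≤ IsPerf k C := by
  rintro M ⟨hM, hfin, n, h0, tM⟩
  obtain ⟨r, hr⟩ := exists_hasRes hA hM hfin h0 tM
  exact hr.isPerf hM

theorem IsTame.kernel {K M N : C ⥤ ModuleCat.{u} k} (i : K ⟶ M) (f : M ⟶ N)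
    (hi : ∀ X, Function.Injective (i.app X)) (hif : ∀ X, Function.Exact (i.app X) (f.app X))
    (tM : IsTame k A M) (tN : IsTame k A N) : IsTame k A K := by
  obtain ⟨hM, hMf, m, hm, tM⟩ := tM
  obtain ⟨hN, hNf, n, hn, tN⟩ := tN
  refine ⟨hM.of_injective i hi, fun X => ?_, max m n + 1, fun X hX => ?_,
    Tame.kernel i f hM hi hif (tM.mono (le_max_left _ _)) (tN.mono (le_max_right _ _))⟩
  · have := hMf X
    exact Module.Finite.of_injective (i.app X).hom (hi X)
  · have := hm X (by omega)
    exact (hi X).subsingleton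

theorem IsTame.cokernel {M N Q : C ⥤ ModuleCat.{u} k} (f : M ⟶ N) (p : N ⟶ Q)
    (hp : ∀ X, Function.Surjective (p.app X)) (hfp : ∀ X, Function.Exact (f.app X) (p.app X))
    (tM : IsTame k A M) (tN : IsTame k A N) : IsTame k A Q := by
  obtain ⟨hM, hMf, m, hm, tM⟩ := tM
  obtain ⟨hN, hNf, n, hn, tN⟩ := tN
  refine ⟨hN.of_surjective p hp, fun X => ?_, max m n, fun X hX => ?_,
    Tame.cokernel f p hM hp hfp (tM.mono (le_max_left _ _)) (tN.mono (le_max_right _ _))⟩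
  · have := hNf X
    exact Module.Finite.of_surjective (p.app X).hom (hp X)
  · have := hn X (by omega)
    exact (hp X).subsingleton

theorem IsTame.pi {ι : Type*} [Finite ι] {F : ι → (C ⥤ ModuleCat.{u} k)} {L : C ⥤ ModuleCat.{u} k}
    (p : ∀ j, L ⟶ F j) (hp : ∀ X, Function.Bijective fun (x : L.obj X) j => (p j).app X x)
    (h : ∀ j, IsTame k A (F j)) : IsTame k A L := by
  choose hF hFf m hm tF using h
  obtain ⟨n, hn⟩ := (Set.finite_range m).bddAbove
  replace hn : ∀ j, m j ≤ n := fun j => hn ⟨j, rfl⟩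
  refine ⟨isLin_pi p (fun X => (hp X).1) hF, fun X => ?_, n, fun X hX => ?_,
    Tame.pi p hp fun j => (tF j).mono (hn j)⟩
  · let f : L.obj X →ₗ[k] (∀ j, (F j).obj X) := LinearMap.pi fun j => ((p j).app X).hom
    have := fun j => hFf j X
    exact Module.Finite.of_injective f (hp X).1
  · have := fun j => hm j X (by have := hn j; omega)
    exact (hp X).1.subsingleton

theorem isTame_coy (hA : A.IsMonomial k) (X : C) : IsTame k A (coy k X) :=
  -- One integer serves both as tameness bound and, negated, as lower bound of the support, which
  -- forces the absolute value of the degree.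
  ⟨isLin_coy X, fun Y => hA.finite_hom X Y, max (A.deg X) (-A.deg X),
    fun Y hY => hA.coy_subsingleton (by omega), (hA.tame_coy X).mono (le_max_left _ _)⟩

theorem IsTame.of_bijective {M N : C ⥤ ModuleCat.{u} k} (hM : IsTame k A M) (f : N ⟶ M)
    (hf : ∀ X, Function.Bijective (f.app X)) : IsTame k A N :=
  IsTame.pi (ι := Unit) (fun _ => f) (fun X => ⟨fun x y h => (hf X).1 (congrFun h ()), fun c => by
    obtain ⟨x, hx⟩ := (hf X).2 (c ())
    exact ⟨x, funext fun _ => hx⟩⟩) fun _ => hM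

theorem IsFree.isTame (hA : A.IsMonomial k) {P : C ⥤ ModuleCat.{u} k} (hP : IsFree k C P) :
    IsTame k A P := by
  obtain ⟨n, X, ⟨e⟩⟩ := hP
  exact (IsTame.pi _ (biproduct_bijective _) fun j => isTame_coy hA (X j)).of_bijective e.hom
    (bijective_app_of_iso e)

theorem isTame_of_isFinPres (hA : A.IsMonomial k) : IsFinPres k C ≤ IsTame k A := by
  rintro M ⟨-, P₁, P₀, d, ε, h₁, h₀, hd, hε⟩
  exact IsTame.cokernel d ε ((epi_iff_app ε).1 hε) ((exactAt_iff_app _ _).1 hd)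
    (h₁.isTame hA) (h₀.isTame hA)

theorem isFinPres_eq_isTame (hA : A.IsMonomial k) : IsFinPres k C = IsTame k A :=
  le_antisymm (isTame_of_isFinPres hA) ((isPerf_of_isTame hA).trans isFinPres_of_isPerf)

theorem isPerf_eq_isFinPres (hA : A.IsMonomial k) : IsPerf k C = IsFinPres k C :=
  le_antisymm isFinPres_of_isPerf ((isTame_of_isFinPres hA).trans (isPerf_of_isTame hA))

/-- The support is finite, so the functor vanishes outside a bounded range of degrees and tameness
above that range is vacuous. -/
theorem isTame_of_isFinTotal : IsFinTotal k C ≤ IsTame k A := by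
  rintro M ⟨hM, hfin, h⟩
  obtain ⟨n, hn⟩ := (h.image fun X => |A.deg X|).bddAbove
  have h0 : ∀ X, n < |A.deg X| → Subsingleton (M.obj X) := by
    intro X hX
    rw [← not_nontrivial_iff_subsingleton]
    intro hX'
    exact absurd (hn ⟨X, hX', rfl⟩) (not_le.2 hX)
  refine ⟨hM, hfin, n, fun X hX => h0 X ?_, Tame.of_subsingleton fun X hX => h0 X ?_⟩
  · exact lt_abs.2 (Or.inr (by omega))
  · exact lt_abs.2 (Or.inl hX)

instance : (IsTame k A).ContainsZero where
  exists_zero := by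
    obtain ⟨Z, hZ⟩ := HasZeroObject.zero (C := C ⥤ ModuleCat.{u} k)
    exact ⟨Z, hZ, IsTame.pi (ι := Empty) (F := fun j => j.elim) (fun j => j.elim)
      (fun X => have := isZero_iff_app.1 hZ X
        ⟨Function.injective_of_subsingleton _, fun c => ⟨0, funext fun j => j.elim⟩⟩)
      (fun j => j.elim)⟩

instance : (IsTame k A).IsClosedUnderKernels where
  kernels_le := by
    rintro _ ⟨f, c, hc, hf⟩
    have := Fork.IsLimit.mono hc
    exact IsTame.kernel c.ι f ((mono_iff_app _).1 this)
      ((exactAt_iff_app _ _).1 (exactAt_of_isLimit hc)) hf.1 hf.2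

instance : (IsTame k A).IsClosedUnderCokernels where
  cokernels_le := by
    rintro _ ⟨f, c, hc, hf⟩
    have := Cofork.IsColimit.epi hc
    exact IsTame.cokernel f c.π ((epi_iff_app _).1 this)
      ((exactAt_iff_app _ _).1 (exactAt_of_isColimit hc)) hf.1 hf.2

instance : (IsTame k A).IsClosedUnderFiniteProducts :=
  isClosedUnderFiniteProducts_of_pi IsTame.pi

end Perfect

/-! ### Abelian subcategories and Serre quotients -/

section Tails

variable {k : Type u} [Field k] {C : Type u} [Category.{u} C] [Preadditive C] [Linear k C]

theorem IsFinTotal.of_injective {M N : C ⥤ ModuleCat.{u} k} (hN : IsFinTotal k C N) (f : M ⟶ N)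
    (hf : ∀ X, Function.Injective (f.app X)) : IsFinTotal k C M := by
  obtain ⟨h, hfin, hs⟩ := hN
  refine ⟨h.of_injective f hf, fun X => ?_, hs.subset fun X hX => ?_⟩
  · have := hfin X
    exact Module.Finite.of_injective (f.app X).hom (hf X)
  · have : Nontrivial (M.obj X) := hX
    exact (hf X).nontrivial

theorem IsFinTotal.of_surjective {M N : C ⥤ ModuleCat.{u} k} (hM : IsFinTotal k C M) (f : M ⟶ N)
    (hf : ∀ X, Function.Surjective (f.app X)) : IsFinTotal k C N := by
  obtain ⟨h, hfin, hs⟩ := hM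
  refine ⟨h.of_surjective f hf, fun X => ?_, hs.subset fun X hX => ?_⟩
  · have := hfin X
    exact Module.Finite.of_surjective (f.app X).hom (hf X)
  · have : Nontrivial (N.obj X) := hX
    exact (hf X).nontrivial

theorem IsFinTotal.of_exact {M' M M'' : C ⥤ ModuleCat.{u} k} (hM : IsLin k C M) (f : M' ⟶ M)
    (g : M ⟶ M'') (h : ∀ X, Function.Exact (f.app X) (g.app X))
    (hg : ∀ X, Function.Surjective (g.app X)) (hM' : IsFinTotal k C M') (hM'' : IsFinTotal k C M'') : IsFinTotal k C M := by
  obtain ⟨-, hfin', hs'⟩ := hM'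
  obtain ⟨-, hfin'', hs''⟩ := hM''
  refine ⟨hM, fun X => ?_, (hs'.union hs'').subset fun X hX => ?_⟩
  · have := hfin' X
    have := hfin'' X
    exact Module.Finite.of_exact (f := (f.app X).hom) (g := (g.app X).hom) (h X) (hg X)
  · by_contra hX'
    simp only [Set.mem_union, Set.mem_ofPred_eq, not_or, not_nontrivial_iff_subsingleton] at hX'
    obtain ⟨h1, h2⟩ := hX'
    have : Nontrivial (M.obj X) := hX
    obtain ⟨m, hm⟩ := exists_ne (0 : M.obj X)
    obtain ⟨x, rfl⟩ := (h X m).1 (Subsingleton.elim _ _)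
    exact hm (by rw [Subsingleton.elim x 0, map_zero])

/-- Closure under kernels, cokernels and finite products makes `Q` abelian with exact inclusion. The
Serre conditions then reduce to dimension counts at each object. -/
theorem exists_abelian_tails (Q : ObjectProperty (C ⥤ ModuleCat.{u} k)) [Q.ContainsZero]
    [Q.IsClosedUnderKernels] [Q.IsClosedUnderCokernels] [Q.IsClosedUnderFiniteProducts]
    (hlin : Q ≤ IsLin k C) :
    ∃ (_ : Abelian Q.FullSubcategory) (_ : ((IsFinTotal k C).inverseImage Q.ι).IsSerreClass),
      Nonempty (Abelian ((IsFinTotal k C).inverseImage Q.ι).isoModSerre.Localization) := by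
  have hadd : Q.ι.Additive := inferInstance
  have hm := Q.preservesMonomorphisms_ι_of_isNormalEpiCategory
  have he := Q.preservesEpimorphisms_ι_of_isNormalMonoCategory
  have hl : PreservesFiniteLimits Q.ι :=
    ((Functor.preservesFiniteLimits_tfae Q.ι).out 2 3).1 fun _ _ f => Q.preservesKernels_ι f
  have hc : PreservesFiniteColimits Q.ι :=
    ((Functor.preservesFiniteColimits_tfae Q.ι).out 2 3).1 fun _ _ f => Q.preservesCokernels_ι f
  have hS : ((IsFinTotal k C).inverseImage Q.ι).IsSerreClass :=
    { exists_zero := by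
        obtain ⟨Z, hZ⟩ := HasZeroObject.zero (C := Q.FullSubcategory)
        have hZ' := isZero_iff_app.1 (Q.ι.map_isZero hZ)
        refine ⟨Z, hZ, hlin _ Z.property, fun X => ?_, ?_⟩
        · have := hZ' X
          infer_instance
        · convert Set.finite_empty
          ext X
          simpa [not_nontrivial_iff_subsingleton] using hZ' X
      prop_of_mono := fun f _ h =>
        IsFinTotal.of_injective h (Q.ι.map f) ((mono_iff_app _).1 inferInstance)
      prop_of_epi := fun f _ h =>
        IsFinTotal.of_surjective h (Q.ι.map f) ((epi_iff_app _).1 inferInstance)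
      prop_X₂_of_shortExact := fun {S} hS h₁ h₃ => by
        have := hS.mono_f
        have := hS.epi_g
        have h := hS.map Q.ι
        exact IsFinTotal.of_exact (hlin _ S.X₂.property) (Q.ι.map S.f) (Q.ι.map S.g)
          ((exactAt_iff_app _ _).1 ⟨_, h.exact⟩) ((epi_iff_app _).1 inferInstance) h₁ h₃ }
  exact ⟨inferInstance, hS, ⟨ObjectProperty.SerreClassLocalization.abelian
    ((IsFinTotal k C).inverseImage Q.ι).isoModSerre.Q
      ((IsFinTotal k C).inverseImage Q.ι)⟩⟩

end Tails

/-! ### The linear structure on the opposite category -/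

section OppositeLinear

variable {k : Type u} [Field k] {C : Type u} [Category.{u} C] [Preadditive C] [Linear k C]

instance : Linear k Cᵒᵖ where
  homModule _ _ :=
    { smul := fun r f => (r • f.unop).op
      one_smul := fun f => Quiver.Hom.unop_inj (one_smul k f.unop)
      mul_smul := fun r s f => Quiver.Hom.unop_inj (mul_smul r s f.unop)
      smul_zero := fun r => Quiver.Hom.unop_inj (smul_zero r)
      smul_add := fun r f g => Quiver.Hom.unop_inj (smul_add r f.unop g.unop)
      add_smul := fun r s f => Quiver.Hom.unop_inj (add_smul r s f.unop)
      zero_smul := fun f => Quiver.Hom.unop_inj (zero_smul k f.unop) }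
  smul_comp _ _ _ r f g := Quiver.Hom.unop_inj (Linear.comp_smul _ _ _ g.unop r f.unop)
  comp_smul _ _ _ f r g := Quiver.Hom.unop_inj (Linear.smul_comp _ _ _ r g.unop f.unop)

variable (k) in
/-- The linear equivalence between morphisms of `Cᵒᵖ` and morphisms of `C`. -/
def unopLinearEquiv (X Y : Cᵒᵖ) : (X ⟶ Y) ≃ₗ[k] (Y.unop ⟶ X.unop) where
  toFun f := f.unop
  invFun f := f.op
  map_add' _ _ := rfl
  map_smul' _ _ := rfl

end OppositeLinear

/-! ### Vector space duality and coperfect functors -/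

section Duality

variable {k : Type u} [Field k]

theorem dual_exact {U V W : Type*} [AddCommGroup U] [AddCommGroup V] [AddCommGroup W] [Module k U]
    [Module k V] [Module k W] {f : U →ₗ[k] V} {g : V →ₗ[k] W} (h : Function.Exact f g) :
    Function.Exact g.dualMap f.dualMap := by
  rw [LinearMap.exact_iff] at h ⊢
  rw [LinearMap.ker_dualMap_eq_dualAnnihilator_range,
    LinearMap.range_dualMap_eq_dualAnnihilator_ker, h]

theorem dual_bijective {ι : Type*} [Fintype ι] {L : Type*} [AddCommGroup L] [Module k L]
    {F : ι → Type*} [∀ j, AddCommGroup (F j)] [∀ j, Module k (F j)] (i : ∀ j, F j →ₗ[k] L)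
    (p : ∀ j, L →ₗ[k] F j) (hpi : ∀ j x, p j (i j x) = x) (hpi' : ∀ j j' x, j ≠ j' → p j' (i j x) = 0)
    (hsum : ∀ x, x = ∑ j, i j (p j x)) :
    Function.Bijective fun (φ : Module.Dual k L) j => (i j).dualMap φ := by
  constructor
  · intro φ ψ h
    ext x
    rw [hsum x, map_sum, map_sum]
    exact Finset.sum_congr rfl fun j _ => LinearMap.congr_fun (congrFun h j) (p j x)
  · intro c
    refine ⟨∑ j, (c j).comp (p j), funext fun j => LinearMap.ext fun x => ?_⟩
    rw [LinearMap.dualMap_apply, LinearMap.sum_apply, Finset.sum_eq_single j]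
    · rw [LinearMap.comp_apply, hpi]
    · intro j' _ hj
      rw [LinearMap.comp_apply, hpi' _ _ _ hj.symm, map_zero]
    · simp

variable (k) in
/-- The duality of vector spaces as a functor. -/
def dualFunctor : (ModuleCat.{u} k)ᵒᵖ ⥤ ModuleCat.{u} k where
  obj V := ModuleCat.of k (Module.Dual k V.unop)
  map f := ModuleCat.ofHom f.unop.hom.dualMap

variable {C : Type u} [Category.{u} C]

/-- The pointwise dual of a covariant functor. -/
abbrev dualRep (M : C ⥤ ModuleCat.{u} k) : Cᵒᵖ ⥤ ModuleCat.{u} k := M.op ⋙ dualFunctor k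

/-- The pointwise dual of a contravariant functor. -/
abbrev codualRep (N : Cᵒᵖ ⥤ ModuleCat.{u} k) : C ⥤ ModuleCat.{u} k := N.rightOp ⋙ dualFunctor k

/-- The pointwise dual of a morphism of covariant functors. -/
abbrev dualRepMap {M N : C ⥤ ModuleCat.{u} k} (f : M ⟶ N) : dualRep N ⟶ dualRep M :=
  Functor.whiskerRight (NatTrans.op f) (dualFunctor k)

/-- The pointwise dual of a morphism of contravariant functors. -/
abbrev codualRepMap {M N : Cᵒᵖ ⥤ ModuleCat.{u} k} (f : M ⟶ N) : codualRep N ⟶ codualRep M :=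
  Functor.whiskerRight (NatTrans.rightOp f) (dualFunctor k)

/-- The canonical morphism to the double dual of a covariant functor. -/
def bidual (M : C ⥤ ModuleCat.{u} k) : M ⟶ codualRep (dualRep M) where
  app X := ModuleCat.ofHom (Module.Dual.eval k (M.obj X))

/-- The canonical morphism to the double dual of a contravariant functor. -/
def cobidual (N : Cᵒᵖ ⥤ ModuleCat.{u} k) : N ⟶ dualRep (codualRep N) where
  app X := ModuleCat.ofHom (Module.Dual.eval k (N.obj X))

theorem bidual_bijective {M : C ⥤ ModuleCat.{u} k} (h : ∀ X, Module.Finite k (M.obj X)) (X : C) :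
    Function.Bijective ((bidual M).app X) :=
  have := h X
  Module.bijective_dual_eval k (M.obj X)

theorem cobidual_bijective {N : Cᵒᵖ ⥤ ModuleCat.{u} k} (h : ∀ X, Module.Finite k (N.obj X))
    (X : Cᵒᵖ) : Function.Bijective ((cobidual N).app X) :=
  have := h X
  Module.bijective_dual_eval k (N.obj X)

theorem dualRepMap_injective {M N : C ⥤ ModuleCat.{u} k} {f : M ⟶ N}
    (h : ∀ X, Function.Surjective (f.app X)) (X : Cᵒᵖ) : Function.Injective ((dualRepMap f).app X) :=
  LinearMap.dualMap_injective_of_surjective (f := (f.app X.unop).hom) (h X.unop)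

theorem dualRepMap_surjective {M N : C ⥤ ModuleCat.{u} k} {f : M ⟶ N}
    (h : ∀ X, Function.Injective (f.app X)) (X : Cᵒᵖ) : Function.Surjective ((dualRepMap f).app X) :=
  LinearMap.dualMap_surjective_of_injective (f := (f.app X.unop).hom) (h X.unop)

theorem dualRepMap_exact {M N L : C ⥤ ModuleCat.{u} k} {f : M ⟶ N} {g : N ⟶ L}
    (h : ∀ X, Function.Exact (f.app X) (g.app X)) (X : Cᵒᵖ) :
    Function.Exact ((dualRepMap g).app X) ((dualRepMap f).app X) :=
  dual_exact (f := (f.app X.unop).hom) (g := (g.app X.unop).hom) (h X.unop)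

theorem codualRepMap_injective {M N : Cᵒᵖ ⥤ ModuleCat.{u} k} {f : M ⟶ N}
    (h : ∀ X, Function.Surjective (f.app X)) (X : C) : Function.Injective ((codualRepMap f).app X) :=
  LinearMap.dualMap_injective_of_surjective (f := (f.app (op X)).hom) (h (op X))

theorem codualRepMap_surjective {M N : Cᵒᵖ ⥤ ModuleCat.{u} k} {f : M ⟶ N}
    (h : ∀ X, Function.Injective (f.app X)) (X : C) : Function.Surjective ((codualRepMap f).app X) :=
  LinearMap.dualMap_surjective_of_injective (f := (f.app (op X)).hom) (h (op X))

theorem codualRepMap_exact {M N L : Cᵒᵖ ⥤ ModuleCat.{u} k} {f : M ⟶ N} {g : N ⟶ L}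
    (h : ∀ X, Function.Exact (f.app X) (g.app X)) (X : C) :
    Function.Exact ((codualRepMap g).app X) ((codualRepMap f).app X) :=
  dual_exact (f := (f.app (op X)).hom) (g := (g.app (op X)).hom) (h (op X))

theorem dual_biproduct_bijective {ι : Type} [Finite ι] (F : ι → (C ⥤ ModuleCat.{u} k)) (X : C) :
    Function.Bijective fun (φ : Module.Dual k ((⨁ F).obj X)) j =>
      ((biproduct.ι F j).app X).hom.dualMap φ := by
  classical
  have := Fintype.ofFinite ι
  refine dual_bijective (fun j => ((biproduct.ι F j).app X).hom)
    (fun j => ((biproduct.π F j).app X).hom) (fun j x => ?_) (fun j j' x h => ?_)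
    (fun x => biproduct_eq_sum F x)
  · exact congrArg (fun f : F j ⟶ F j => (f.app X).hom x) (biproduct.ι_π_self F j)
  · exact congrArg (fun f : F j ⟶ F j' => (f.app X).hom x) (biproduct.ι_π_ne F h)

variable [Preadditive C] [Linear k C]

theorem isLin_dualRep {M : C ⥤ ModuleCat.{u} k} (hM : IsLin k C M) : IsLin k Cᵒᵖ (dualRep M) :=
  IsLin.mk'
    (fun {X _} f g (φ : Module.Dual k (M.obj X.unop)) => LinearMap.ext fun m =>
      (congrArg φ (hM.map_add f.unop g.unop m)).trans (map_add φ _ _))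
    (fun {X _} r f (φ : Module.Dual k (M.obj X.unop)) => LinearMap.ext fun m =>
      (congrArg φ (hM.map_smul r f.unop m)).trans (map_smul φ _ _))

variable (k) in
/-- The dual of the contravariant functor represented by an object. -/
def corep (X : C) : C ⥤ ModuleCat.{u} k where
  obj Y := ModuleCat.of k (Module.Dual k (Y ⟶ X))
  map f := ModuleCat.ofHom (Linear.leftComp k X f).dualMap

/-- `corep` is the pointwise dual of a representable functor on the opposite category. -/
def codualCoyIso (X : Cᵒᵖ) : codualRep (coy k X) ≅ corep k X.unop :=
  NatIso.ofComponents
    (fun Y => ((unopLinearEquiv k X (op Y)).symm.dualMap).toModuleIso)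
    (fun _ => rfl)

variable (k C) in
/-- Finite direct sums of the functors `corep`. -/
def IsCofree : ObjectProperty (C ⥤ ModuleCat.{u} k) :=
  fun J => ∃ (n : ℕ) (X : Fin n → C), Nonempty (J ≅ ⨁ fun j => corep k (X j))

theorem IsFree.isCofree_codualRep {P : Cᵒᵖ ⥤ ModuleCat.{u} k} (hP : IsFree k Cᵒᵖ P) :
    IsCofree k C (codualRep P) := by
  obtain ⟨n, X, ⟨e⟩⟩ := hP
  have h1 : Nonempty (codualRep (⨁ fun j => coy k (X j)) ≅ ⨁ fun j => corep k (X j).unop) := by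
    refine nonempty_iso_biproduct
      (fun j => codualRepMap (biproduct.ι (fun j => coy k (X j)) j) ≫ (codualCoyIso (X j)).hom) ?_
    intro Y
    have h2 := dual_biproduct_bijective (fun j => coy k (X j)) (op Y)
    have h3 := fun j => bijective_app_of_iso (codualCoyIso (k := k) (X j)) Y
    exact (Function.Bijective.piMap h3).comp h2
  obtain ⟨f⟩ := h1
  have he := bijective_app_of_iso e.symm
  obtain ⟨g⟩ := nonempty_iso_of_bijective (codualRepMap e.inv) fun Y =>
    ⟨codualRepMap_injective (fun X => (he X).2) Y, codualRepMap_surjective (fun X => (he X).1) Y⟩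
  exact ⟨n, fun j => (X j).unop, ⟨g ≪≫ f⟩⟩


variable (k C) in
/-- Kernels of morphisms between finite direct sums of the functors `corep`. -/
def IsFinCopres : ObjectProperty (C ⥤ ModuleCat.{u} k) := fun N =>
  IsLin k C N ∧ ∃ (J₀ J₁ : C ⥤ ModuleCat.{u} k) (η : N ⟶ J₀) (d : J₀ ⟶ J₁),
    IsCofree k C J₀ ∧ IsCofree k C J₁ ∧ Mono η ∧ ExactAt η d

variable (k C) in
/-- Functors with a finite coresolution by finite direct sums of the functors `corep`. -/
def IsCoperf : ObjectProperty (C ⥤ ModuleCat.{u} k) := fun N =>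
  IsLin k C N ∧ ∃ (n : ℕ) (J : ℕ → (C ⥤ ModuleCat.{u} k)) (d : ∀ i, J i ⟶ J (i + 1))
    (η : N ⟶ J 0),
    (∀ i, IsCofree k C (J i)) ∧ (∀ i, n < i → IsZero (J i)) ∧
    Mono η ∧ ExactAt η (d 0) ∧ ∀ i, ExactAt (d i) (d (i + 1))

variable (k) in
/-- Locally finite-dimensional linear functors whose pointwise dual is tame. -/
def IsCotame (A : ArrowSystem Cᵒᵖ) : ObjectProperty (C ⥤ ModuleCat.{u} k) := fun M =>
  IsLin k C M ∧ (∀ X, Module.Finite k (M.obj X)) ∧ IsTame k A (dualRep M)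

variable {A : ArrowSystem Cᵒᵖ}

/-- Pointwise duality is exact and contravariant, so this is stability of tame functors under
cokernels over `Cᵒᵖ`. -/
theorem IsCotame.kernel {K M N : C ⥤ ModuleCat.{u} k} (i : K ⟶ M) (f : M ⟶ N)
    (hi : ∀ X, Function.Injective (i.app X)) (hif : ∀ X, Function.Exact (i.app X) (f.app X))
    (tM : IsCotame k A M) (tN : IsCotame k A N) : IsCotame k A K := by
  obtain ⟨hM, hMf, tM⟩ := tM
  refine ⟨hM.of_injective i hi, fun X => ?_, IsTame.cokernel (dualRepMap f) (dualRepMap i)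
    (dualRepMap_surjective hi) (dualRepMap_exact hif) tN.2.2 tM⟩
  have := hMf X
  exact Module.Finite.of_injective (i.app X).hom (hi X)

theorem IsCotame.cokernel {M N Q : C ⥤ ModuleCat.{u} k} (f : M ⟶ N) (p : N ⟶ Q)
    (hp : ∀ X, Function.Surjective (p.app X)) (hfp : ∀ X, Function.Exact (f.app X) (p.app X))
    (tM : IsCotame k A M) (tN : IsCotame k A N) : IsCotame k A Q := by
  obtain ⟨hN, hNf, tN⟩ := tN
  refine ⟨hN.of_surjective p hp, fun X => ?_, IsTame.kernel (dualRepMap p) (dualRepMap f)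
    (dualRepMap_injective hp) (dualRepMap_exact hfp) tN tM.2.2⟩
  have := hNf X
  exact Module.Finite.of_surjective (p.app X).hom (hp X)

theorem IsCotame.pi {ι : Type} [Finite ι] {F : ι → (C ⥤ ModuleCat.{u} k)}
    {L : C ⥤ ModuleCat.{u} k} (p : ∀ j, L ⟶ F j)
    (hp : ∀ X, Function.Bijective fun (x : L.obj X) j => (p j).app X x)
    (h : ∀ j, IsCotame k A (F j)) : IsCotame k A L := by
  refine ⟨isLin_pi p (fun X => (hp X).1) fun j => (h j).1, fun X => ?_, ?_⟩
  · let f : L.obj X →ₗ[k] (∀ j, (F j).obj X) := LinearMap.pi fun j => ((p j).app X).hom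
    have := fun j => (h j).2.1 X
    exact Module.Finite.of_injective f (hp X).1
  · obtain ⟨e⟩ := nonempty_iso_biproduct p hp
    have he := bijective_app_of_iso e.symm
    refine IsTame.of_bijective (M := dualRep (⨁ F)) ?_ (dualRepMap e.inv) fun X =>
      ⟨dualRepMap_injective (fun X => (he X).2) X, dualRepMap_surjective (fun X => (he X).1) X⟩
    exact IsTame.pi (fun j => dualRepMap (biproduct.ι F j))
      (fun X => dual_biproduct_bijective F X.unop) fun j => (h j).2.2

/-- The dual of `corep` is the double dual of a representable on `Cᵒᵖ`, which is that representable
since morphism spaces are finite-dimensional. -/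
theorem isCotame_corep (hA : A.IsMonomial k) (X : C) : IsCotame k A (corep k X) := by
  have hf : ∀ Y : C, Module.Finite k (Y ⟶ X) := fun Y => by
    have := hA.finite_hom (op X) (op Y)
    exact Module.Finite.equiv (unopLinearEquiv k (op X) (op Y))
  refine ⟨IsLin.mk'
    (fun {Y Z} f g (φ : Module.Dual k (Y ⟶ X)) => LinearMap.ext fun (m : Z ⟶ X) =>
      (congrArg φ (Preadditive.add_comp _ _ _ f g m)).trans (map_add φ _ _))
    (fun {Y Z} r f (φ : Module.Dual k (Y ⟶ X)) => LinearMap.ext fun (m : Z ⟶ X) =>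
      (congrArg φ (Linear.smul_comp _ _ _ r f m)).trans (map_smul φ _ _)), fun Y => ?_, ?_⟩
  · have := hf Y
    exact inferInstanceAs (Module.Finite k (Module.Dual k (Y ⟶ X)))
  · have hc := cobidual_bijective (N := coy k (op X)) fun Y => hA.finite_hom (op X) Y
    have he := bijective_app_of_iso (codualCoyIso (k := k) (op X))
    have h1 : IsTame k A (dualRep (codualRep (coy k (op X)))) := by
      obtain ⟨e⟩ := nonempty_iso_of_bijective _ hc
      exact (isTame_coy hA (op X)).of_bijective e.inv (bijective_app_of_iso e.symm)
    exact h1.of_bijective (dualRepMap (codualCoyIso (op X)).hom) fun Y =>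
      ⟨dualRepMap_injective (fun X => (he X).2) Y, dualRepMap_surjective (fun X => (he X).1) Y⟩

theorem IsCotame.of_bijective {M N : C ⥤ ModuleCat.{u} k} (hM : IsCotame k A M) (f : N ⟶ M)
    (hf : ∀ X, Function.Bijective (f.app X)) : IsCotame k A N :=
  IsCotame.pi (ι := Unit) (fun _ => f) (fun X => ⟨fun x y h => (hf X).1 (congrFun h ()), fun c => by
    obtain ⟨x, hx⟩ := (hf X).2 (c ())
    exact ⟨x, funext fun _ => hx⟩⟩) fun _ => hM

theorem IsCofree.isCotame (hA : A.IsMonomial k) {J : C ⥤ ModuleCat.{u} k} (hJ : IsCofree k C J) :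
    IsCotame k A J := by
  obtain ⟨n, X, ⟨e⟩⟩ := hJ
  exact (IsCotame.pi _ (biproduct_bijective _) fun j => isCotame_corep hA (X j)).of_bijective e.hom
    (bijective_app_of_iso e)

theorem isCotame_of_isFinCopres (hA : A.IsMonomial k) : IsFinCopres k C ≤ IsCotame k A := by
  rintro N ⟨-, J₀, J₁, η, d, h₀, h₁, hη, hd⟩
  exact IsCotame.kernel η d ((mono_iff_app η).1 hη) ((exactAt_iff_app _ _).1 hd)
    (h₀.isCotame hA) (h₁.isCotame hA)

theorem isFinCopres_of_isCoperf : IsCoperf k C ≤ IsFinCopres k C := by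
  rintro N ⟨hN, n, J, d, η, hJ, -, hη, h, -⟩
  exact ⟨hN, J 0, J 1, η, d 0, hJ 0, hJ 1, hη, h⟩

/-- A finite free resolution of the dual of `M` over `Cᵒᵖ` dualizes to a coresolution of the double
dual, which is `M` by local finiteness. -/
theorem isCoperf_of_isCotame (hA : A.IsMonomial k) : IsCotame k A ≤ IsCoperf k C := by
  rintro M ⟨hM, hMf, tM⟩
  obtain ⟨-, n, P, d, ε, hP, hn, hε, h0, hd⟩ := isPerf_of_isTame hA _ tM
  have hb := bidual_bijective hMf
  have hε' := codualRepMap_injective ((epi_iff_app ε).1 hε)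
  refine ⟨hM, n, fun i => codualRep (P i), fun i => codualRepMap (d i),
    bidual M ≫ codualRepMap ε, fun i => (hP i).isCofree_codualRep, fun i hi => ?_, ?_, ?_, ?_⟩
  · rw [isZero_iff_app]
    intro X
    have := isZero_iff_app.1 (hn i hi) (op X)
    exact inferInstanceAs (Subsingleton (Module.Dual k ((P i).obj (op X))))
  · exact (mono_iff_app _).2 fun X => (hε' X).comp (hb X).1
  · rw [exactAt_iff_app] at h0 ⊢
    intro X x
    rw [codualRepMap_exact h0 X x]
    constructor
    · rintro ⟨y, rfl⟩
      obtain ⟨z, rfl⟩ := (hb X).2 y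
      exact ⟨z, rfl⟩
    · rintro ⟨z, rfl⟩
      exact ⟨_, rfl⟩
  · intro i
    have := hd i
    rw [exactAt_iff_app] at this ⊢
    exact codualRepMap_exact this

theorem isFinCopres_eq_isCotame (hA : A.IsMonomial k) : IsFinCopres k C = IsCotame k A :=
  le_antisymm (isCotame_of_isFinCopres hA) ((isCoperf_of_isCotame hA).trans isFinCopres_of_isCoperf)

theorem isCoperf_eq_isFinCopres (hA : A.IsMonomial k) : IsCoperf k C = IsFinCopres k C :=
  le_antisymm isFinCopres_of_isCoperf ((isCotame_of_isFinCopres hA).trans (isCoperf_of_isCotame hA))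

theorem isCotame_of_isFinTotal : IsFinTotal k C ≤ IsCotame k A := by
  rintro M ⟨hM, hfin, h⟩
  refine ⟨hM, hfin, isTame_of_isFinTotal _ ⟨isLin_dualRep hM, fun X => ?_, ?_⟩⟩
  · have := hfin X.unop
    exact inferInstanceAs (Module.Finite k (Module.Dual k (M.obj X.unop)))
  · refine (h.image op).subset fun X hX => ⟨X.unop, ?_, rfl⟩
    by_contra hX'
    have := not_nontrivial_iff_subsingleton.1 hX'
    have h1 : Subsingleton (Module.Dual k (M.obj X.unop)) := inferInstance
    exact not_nontrivial_iff_subsingleton.2 h1 hX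

instance : (IsCotame k A).ContainsZero where
  exists_zero := by
    obtain ⟨Z, hZ⟩ := HasZeroObject.zero (C := C ⥤ ModuleCat.{u} k)
    exact ⟨Z, hZ, IsCotame.pi (ι := Empty) (F := fun j => j.elim) (fun j => j.elim)
      (fun X => have := isZero_iff_app.1 hZ X
        ⟨Function.injective_of_subsingleton _, fun c => ⟨0, funext fun j => j.elim⟩⟩)
      (fun j => j.elim)⟩

instance : (IsCotame k A).IsClosedUnderKernels where
  kernels_le := by
    rintro _ ⟨f, c, hc, hf⟩
    have := Fork.IsLimit.mono hc
    exact IsCotame.kernel c.ι f ((mono_iff_app _).1 this)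
      ((exactAt_iff_app _ _).1 (exactAt_of_isLimit hc)) hf.1 hf.2

instance : (IsCotame k A).IsClosedUnderCokernels where
  cokernels_le := by
    rintro _ ⟨f, c, hc, hf⟩
    have := Cofork.IsColimit.epi hc
    exact IsCotame.cokernel f c.π ((epi_iff_app _).1 this)
      ((exactAt_iff_app _ _).1 (exactAt_of_isColimit hc)) hf.1 hf.2

instance : (IsCotame k A).IsClosedUnderFiniteProducts :=
  isClosedUnderFiniteProducts_of_pi IsCotame.pi

end Duality

/-! ### Paths avoiding the relations -/

section Paths

variable {V : Type u} [Quiver.{u} V] (S : QuadRel V)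

/-- Paths none of whose subpaths of length two belongs to `S`. -/
def Avoids {a b : V} (p : Quiver.Path a b) : Prop :=
  ∀ (c d e : V) (p' : Quiver.Path a c) (α : c ⟶ d) (β : d ⟶ e) (q : Quiver.Path e b),
    S α β → p ≠ ((p'.cons α).cons β).comp q

variable {S}

theorem Avoids.left {a b c : V} {p : Quiver.Path a b} {q : Quiver.Path b c}
    (h : Avoids S (p.comp q)) : Avoids S p := by
  rintro c d e p' α β q' hS rfl
  exact h c d e p' α β (q'.comp q) hS (Quiver.Path.comp_assoc _ _ _)

theorem Avoids.right {a b c : V} {p : Quiver.Path a b} {q : Quiver.Path b c}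
    (h : Avoids S (p.comp q)) : Avoids S q := by
  rintro c d e p' α β q' hS rfl
  exact h c d e (p.comp p') α β q' hS (by rw [← Quiver.Path.comp_assoc]; rfl)

theorem Avoids.not_rel {a b c d e : V} {p : Quiver.Path a b} {α : b ⟶ c} {β : c ⟶ d}
    {q : Quiver.Path d e} (h : Avoids S (((p.cons α).cons β).comp q)) : ¬ S α β :=
  fun hS => h _ _ _ p α β q hS rfl

theorem avoids_toPath {a b : V} (α : a ⟶ b) : Avoids S α.toPath := by
  intro c d e p' α β q _ h
  have := congrArg Quiver.Path.length h
  simp at this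
  omega

theorem Avoids.cons_cons {a b c d : V} {p : Quiver.Path a b} {α : b ⟶ c} {β : c ⟶ d}
    (h : Avoids S (p.cons α)) (hS : ¬ S α β) : Avoids S ((p.cons α).cons β) := by
  intro c' d' e' p' α' β' q hS' he
  cases q with
  | nil =>
    rw [Quiver.Path.comp_nil] at he
    cases he
    exact hS hS'
  | cons q ε =>
    rw [Quiver.Path.comp_cons] at he
    obtain rfl := Quiver.Path.obj_eq_of_cons_eq_cons he
    exact h _ _ _ p' α' β' q hS' (eq_of_heq (Quiver.Path.heq_of_cons_eq_cons he))

/-- Relations have length two, so any one occurring in the glued path already lies in one of the two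
pieces sharing the arrow `α`. -/
theorem Avoids.comp {a b c d : V} {p : Quiver.Path a b} {α : b ⟶ c} {q : Quiver.Path c d}
    (hp : Avoids S (p.cons α)) (hq : Avoids S (α.toPath.comp q)) :
    Avoids S ((p.cons α).comp q) := by
  induction q with
  | nil => exact hp
  | cons q β ih =>
    cases q with
    | nil => exact hp.cons_cons (Avoids.not_rel (p := Quiver.Path.nil) (q := Quiver.Path.nil) hq)
    | cons q ε =>
      exact Avoids.cons_cons (ih (Avoids.left (q := β.toPath) hq))
        (Avoids.not_rel (p := α.toPath.comp q) (q := Quiver.Path.nil) hq)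

theorem finite_paths_of_length [Finite V] [∀ a b : V, Finite (a ⟶ b)] (a : V) (n : ℕ) (b : V) :
    {p : Quiver.Path a b | p.length = n}.Finite := by
  induction n generalizing b with
  | zero =>
    refine Set.Subsingleton.finite fun p hp q hq => ?_
    cases p with
    | nil => exact (Quiver.Path.eq_nil_of_length_zero q hq).symm
    | cons p α => exact absurd hp (Nat.succ_ne_zero _)
  | succ n ih =>
    refine (Set.finite_iUnion fun c : V => Set.finite_iUnion fun α : c ⟶ b =>
      (ih c).image fun p => p.cons α).subset fun p hp => ?_
    cases p with
    | nil => exact absurd hp.symm (Nat.succ_ne_zero _)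
    | cons p α =>
      simp only [Set.mem_iUnion]
      exact ⟨_, α, p, Nat.succ_injective hp, rfl⟩

end Paths

/-! ### The basis of relation-avoiding paths -/

section Coefficients

variable {k : Type u} [Field k] {V : Type u} [Quiver.{u} V] {S : QuadRel V}

variable (k) in
/-- The coefficient of a path avoiding the relations. -/
def coef {a b : V} {p : Quiver.Path a b} (hp : Avoids S p) : Lam k S a b →ₗ[k] k :=
  (ideal k S a b).liftQ (Finsupp.lapply p) (by
    rw [ideal, Submodule.span_le]
    rintro _ ⟨c, d, e, p', α, β, q, hS, rfl⟩
    exact Finsupp.single_eq_of_ne (hp c d e p' α β q hS))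

theorem coef_ofPath {a b : V} {p : Quiver.Path a b} (hp : Avoids S p) (q : Quiver.Path a b)
    [Decidable (q = p)] : coef k hp (Lam.ofPath k S q) = if q = p then 1 else 0 := by
  classical
  change Finsupp.single q (1 : k) p = _
  rw [Finsupp.single_apply]

theorem coef_ofPath_self {a b : V} {p : Quiver.Path a b} (hp : Avoids S p) :
    coef k hp (Lam.ofPath k S p) = 1 := by
  classical
  rw [coef_ofPath, if_pos rfl]

theorem coef_ofPath_of_ne {a b : V} {p q : Quiver.Path a b} (hp : Avoids S p) (h : q ≠ p) :
    coef k hp (Lam.ofPath k S q) = 0 := by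
  classical
  rw [coef_ofPath, if_neg h]

/-- Paths containing a relation vanish in the quotient, so an element is determined by its
coefficients at the avoiding paths. -/
theorem eq_zero_of_coef {a b : V} {x : Lam k S a b}
    (h : ∀ (p : Quiver.Path a b) (hp : Avoids S p), coef k hp x = 0) : x = 0 := by
  obtain ⟨f, rfl⟩ := (ideal k S a b).mkQ_surjective x
  rw [Submodule.mkQ_apply, Submodule.Quotient.mk_eq_zero, ← Finsupp.sum_single f]
  refine Submodule.sum_mem _ fun p hp => ?_
  by_cases h' : Avoids S p
  · exact absurd (h p h') (Finsupp.mem_support_iff.1 hp)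
  · simp only [Avoids, not_forall, not_not] at h'
    obtain ⟨c, d, e, p', α, β, q, hS, hpe⟩ := h'
    rw [← mul_one (f p), ← smul_eq_mul, ← Finsupp.smul_single]
    exact Submodule.smul_mem _ _ (Submodule.subset_span ⟨c, d, e, p', α, β, q, hS, by rw [hpe]⟩)

theorem coef_mul_ofPath {a b c : V} (x : Lam k S a b) {s : Quiver.Path a b} {r : Quiver.Path b c}
    (h : Avoids S (s.comp r)) :
    coef k h (Lam.mul k S a b c x (Lam.ofPath k S r)) = coef k h.left x := by
  classical
  induction x using Lam.induction k with
  | zero => simp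
  | add x y hx hy => simp only [map_add, LinearMap.add_apply, hx, hy]
  | smul t x hx => simp only [map_smul, LinearMap.smul_apply, hx]
  | path p => simp only [Lam.mul_ofPath, coef_ofPath, Quiver.Path.comp_inj_left]

theorem coef_mul_ofPath_of_ne {a b c : V} (x : Lam k S a b) {p : Quiver.Path a c}
    {r : Quiver.Path b c} (hp : Avoids S p) (h : ∀ s : Quiver.Path a b, p ≠ s.comp r) :
    coef k hp (Lam.mul k S a b c x (Lam.ofPath k S r)) = 0 := by
  induction x using Lam.induction k with
  | zero => simp
  | add x y hx hy => simp only [map_add, LinearMap.add_apply, hx, hy, add_zero]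
  | smul t x hx => simp only [map_smul, LinearMap.smul_apply, hx, smul_zero]
  | path q => rw [Lam.mul_ofPath, coef_ofPath_of_ne _ (h q).symm]

theorem coef_ofPath_mul {a b c : V} {r : Quiver.Path a b} (x : Lam k S b c) {s : Quiver.Path b c}
    (h : Avoids S (r.comp s)) :
    coef k h (Lam.mul k S a b c (Lam.ofPath k S r) x) = coef k h.right x := by
  classical
  induction x using Lam.induction k with
  | zero => simp
  | add x y hx hy => simp only [map_add, hx, hy]
  | smul t x hx => simp only [map_smul, hx]
  | path p => simp only [Lam.mul_ofPath, coef_ofPath, Quiver.Path.comp_inj_right]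

theorem coef_ofPath_mul_of_ne {a b c : V} {r : Quiver.Path a b} (x : Lam k S b c)
    {p : Quiver.Path a c} (hp : Avoids S p) (h : ∀ s : Quiver.Path b c, p ≠ r.comp s) :
    coef k hp (Lam.mul k S a b c (Lam.ofPath k S r) x) = 0 := by
  induction x using Lam.induction k with
  | zero => simp
  | add x y hx hy => simp only [map_add, hx, hy, add_zero]
  | smul t x hx => simp only [map_smul, hx, smul_zero]
  | path q => rw [Lam.mul_ofPath, coef_ofPath_of_ne _ (h q).symm]

theorem cons_inj_sigma {a b : V} {γ γ' : Σ v : V, v ⟶ b} {s : Quiver.Path a γ.1}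
    {s' : Quiver.Path a γ'.1} (h : s.comp γ.2.toPath = s'.comp γ'.2.toPath) : γ = γ' := by
  obtain ⟨v, γ⟩ := γ
  obtain ⟨v', γ'⟩ := γ'
  replace h : s.cons γ = s'.cons γ' := h
  cases h
  rfl

theorem toPath_comp_inj_sigma {a b : V} {γ γ' : Σ v : V, a ⟶ v} {s : Quiver.Path γ.1 b}
    {s' : Quiver.Path γ'.1 b} (h : γ.2.toPath.comp s = γ'.2.toPath.comp s') : γ = γ' := by
  obtain ⟨v, γ⟩ := γ
  obtain ⟨v', γ'⟩ := γ'
  dsimp only at s s' h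
  induction s with
  | nil =>
    cases s' with
    | nil => cases h; rfl
    | cons s' ε =>
      have := congrArg Quiver.Path.length h
      simp at this
  | cons s ε ih =>
    cases s' with
    | nil =>
      have := congrArg Quiver.Path.length h
      simp at this
    | cons s' ε' =>
      rw [Quiver.Path.comp_cons, Quiver.Path.comp_cons] at h
      obtain rfl := Quiver.Path.obj_eq_of_cons_eq_cons h
      exact ih (eq_of_heq (Quiver.Path.heq_of_cons_eq_cons h))

/-- A path has a unique last arrow, so the summands involve disjoint sets of basis paths. -/
theorem mul_arrow_indep {a b : V} [Fintype (Σ v : V, v ⟶ b)]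
    (c : ∀ γ : (Σ v : V, v ⟶ b), Lam k S a γ.1)
    (h : ∑ γ, Lam.mul k S a γ.1 b (c γ) (Lam.ofPath k S γ.2.toPath) = 0)
    (γ : Σ v : V, v ⟶ b) : Lam.mul k S a γ.1 b (c γ) (Lam.ofPath k S γ.2.toPath) = 0 := by
  refine eq_zero_of_coef fun p hp => ?_
  by_cases hs : ∃ s : Quiver.Path a γ.1, p = s.comp γ.2.toPath
  · obtain ⟨s, rfl⟩ := hs
    have h' := congrArg (coef k hp) h
    rw [map_sum, map_zero, Finset.sum_eq_single γ] at h'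
    · exact h'
    · intro γ' _ hγ
      exact coef_mul_ofPath_of_ne _ _ fun s' hs' => hγ (cons_inj_sigma hs').symm
    · simp
  · exact coef_mul_ofPath_of_ne _ _ fun s hs' => hs ⟨s, hs'⟩

theorem arrow_mul_indep {a b : V} [Fintype (Σ v : V, a ⟶ v)]
    (c : ∀ γ : (Σ v : V, a ⟶ v), Lam k S γ.1 b)
    (h : ∑ γ, Lam.mul k S a γ.1 b (Lam.ofPath k S γ.2.toPath) (c γ) = 0)
    (γ : Σ v : V, a ⟶ v) : Lam.mul k S a γ.1 b (Lam.ofPath k S γ.2.toPath) (c γ) = 0 := by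
  refine eq_zero_of_coef fun p hp => ?_
  by_cases hs : ∃ s : Quiver.Path γ.1 b, p = γ.2.toPath.comp s
  · obtain ⟨s, rfl⟩ := hs
    have h' := congrArg (coef k hp) h
    rw [map_sum, map_zero, Finset.sum_eq_single γ] at h'
    · exact h'
    · intro γ' _ hγ
      exact coef_ofPath_mul_of_ne _ _ fun s' hs' => hγ (toPath_comp_inj_sigma hs').symm
    · simp
  · exact coef_ofPath_mul_of_ne _ _ fun s hs' => hs ⟨s, hs'⟩

/-- Whether a basis path stays nonzero after appending `γ` depends only on its last arrow `δ`. When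
`δ` and `γ` compose legally, right multiplication by `γ` therefore preserves the coefficient. -/
theorem mul_arrow_inj {a b d : V} [Fintype (Σ v : V, v ⟶ b)] (γ : b ⟶ d)
    (c : ∀ δ : (Σ v : V, v ⟶ b), Lam k S a δ.1) (hc : ∀ δ, S δ.2 γ → c δ = 0)
    (h : Lam.mul k S a b d (∑ δ, Lam.mul k S a δ.1 b (c δ) (Lam.ofPath k S δ.2.toPath))
      (Lam.ofPath k S γ.toPath) = 0) :
    ∑ δ, Lam.mul k S a δ.1 b (c δ) (Lam.ofPath k S δ.2.toPath) = 0 := by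
  refine eq_zero_of_coef fun p hp => ?_
  by_cases hs : ∃ (δ : Σ v : V, v ⟶ b) (s : Quiver.Path a δ.1), p = s.comp δ.2.toPath ∧ ¬ S δ.2 γ
  · obtain ⟨δ, s, rfl, hS⟩ := hs
    have hp' : Avoids S ((s.comp δ.2.toPath).comp γ.toPath) := Avoids.cons_cons hp hS
    rw [← coef_mul_ofPath _ hp', h, map_zero]
  · rw [map_sum]
    refine Finset.sum_eq_zero fun δ _ => ?_
    by_cases hS : S δ.2 γ
    · rw [hc δ hS, map_zero, LinearMap.zero_apply, map_zero]
    · exact coef_mul_ofPath_of_ne _ _ fun s hs' => hs ⟨δ, s, hs', hS⟩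

theorem arrow_mul_inj {a b d : V} [Fintype (Σ v : V, a ⟶ v)] (γ : d ⟶ a)
    (c : ∀ δ : (Σ v : V, a ⟶ v), Lam k S δ.1 b) (hc : ∀ δ, S γ δ.2 → c δ = 0)
    (h : Lam.mul k S d a b (Lam.ofPath k S γ.toPath)
      (∑ δ, Lam.mul k S a δ.1 b (Lam.ofPath k S δ.2.toPath) (c δ)) = 0) :
    ∑ δ, Lam.mul k S a δ.1 b (Lam.ofPath k S δ.2.toPath) (c δ) = 0 := by
  refine eq_zero_of_coef fun p hp => ?_
  by_cases hs : ∃ (δ : Σ v : V, a ⟶ v) (s : Quiver.Path δ.1 b), p = δ.2.toPath.comp s ∧ ¬ S γ δ.2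
  · obtain ⟨δ, s, rfl, hS⟩ := hs
    have hp' : Avoids S (γ.toPath.comp (δ.2.toPath.comp s)) := by
      rw [← Quiver.Path.comp_assoc]
      exact Avoids.comp (Avoids.cons_cons (p := Quiver.Path.nil) (avoids_toPath γ) hS) hp
    rw [← coef_ofPath_mul _ hp', h, map_zero]
  · rw [map_sum]
    refine Finset.sum_eq_zero fun δ _ => ?_
    by_cases hS : S γ δ.2
    · rw [hc δ hS, map_zero, map_zero]
    · exact coef_ofPath_mul_of_ne _ _ fun s hs' => hs ⟨δ, s, hs', hS⟩

theorem exists_eq_sum_mul_arrow {a b : V} [Fintype (Σ v : V, v ⟶ b)] {n m : ℤ} (hn : 0 < n)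
    (hm : m + 1 = n) {x : Lam k S a b} (hx : x ∈ Lam.component k S a b n) :
    ∃ c : ∀ γ : (Σ v : V, v ⟶ b), Lam.component k S a γ.1 m,
      x = ∑ γ, Lam.mul k S a γ.1 b (c γ) (Lam.ofPath k S γ.2.toPath) := by
  classical
  induction hx using Submodule.span_induction with
  | zero => exact ⟨0, by simp⟩
  | add x y _ _ hx hy =>
    obtain ⟨c, hc⟩ := hx
    obtain ⟨d, hd⟩ := hy
    exact ⟨c + d, by simp [hc, hd, Finset.sum_add_distrib]⟩
  | smul r x _ hx =>
    obtain ⟨c, hc⟩ := hx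
    exact ⟨r • c, by simp [hc, Finset.smul_sum]⟩
  | mem x hx =>
    obtain ⟨p, hp, rfl⟩ := hx
    cases p with
    | nil => simp at hp; omega
    | @cons v _ p γ =>
      refine ⟨Pi.single ⟨v, γ⟩ ⟨Lam.ofPath k S p, Submodule.subset_span ⟨p, ?_, rfl⟩⟩, ?_⟩
      · rw [Quiver.Path.length_cons] at hp
        push_cast at hp
        dsimp only
        omega
      · rw [Finset.sum_eq_single ⟨v, γ⟩]
        · rw [Pi.single_eq_same, Lam.mul_ofPath]
          rfl
        · intro δ _ hδ
          rw [Pi.single_eq_of_ne hδ]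
          simp
        · simp

theorem exists_eq_sum_arrow_mul {a b : V} [Fintype (Σ v : V, a ⟶ v)] {n m : ℤ} (hn : 0 < n)
    (hm : m + 1 = n) {x : Lam k S a b} (hx : x ∈ Lam.component k S a b n) :
    ∃ c : ∀ γ : (Σ v : V, a ⟶ v), Lam.component k S γ.1 b m,
      x = ∑ γ, Lam.mul k S a γ.1 b (Lam.ofPath k S γ.2.toPath) (c γ) := by
  classical
  induction hx using Submodule.span_induction with
  | zero => exact ⟨0, by simp⟩
  | add x y _ _ hx hy =>
    obtain ⟨c, hc⟩ := hx
    obtain ⟨d, hd⟩ := hy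
    exact ⟨c + d, by simp [hc, hd, Finset.sum_add_distrib]⟩
  | smul r x _ hx =>
    obtain ⟨c, hc⟩ := hx
    exact ⟨r • c, by simp [hc, Finset.smul_sum]⟩
  | mem x hx =>
    obtain ⟨p, hp, rfl⟩ := hx
    obtain ⟨l, hl⟩ : ∃ l : ℕ, p.length = l + 1 := Nat.exists_eq_succ_of_ne_zero (by omega)
    obtain ⟨v, γ, q, rfl, hq⟩ := p.eq_toPath_comp_of_length_eq_succ hl
    refine ⟨Pi.single ⟨v, γ⟩ ⟨Lam.ofPath k S q, Submodule.subset_span ⟨q, ?_, rfl⟩⟩, ?_⟩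
    · dsimp only
      omega
    · rw [Finset.sum_eq_single ⟨v, γ⟩]
      · rw [Pi.single_eq_same, Lam.mul_ofPath, hq]
      · intro δ _ hδ
        rw [Pi.single_eq_of_ne hδ]
        simp
      · simp

end Coefficients

/-! ### The arrow systems of a graded monomial category and of its opposite -/

section GradedObjects

variable {k : Type u} [Field k] {V : Type u} [Quiver.{u} V] {S : QuadRel V}

theorem finite_component [Finite V] [∀ a b : V, Finite (a ⟶ b)] (a b : V) (n : ℤ) :
    Module.Finite k (Lam.component k S a b n) := by
  refine Module.Finite.iff_fg.2 (Submodule.fg_span ?_)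
  refine (((finite_paths_of_length a n.toNat b).image (Lam.ofPath k S))).subset ?_
  rintro _ ⟨p, hp, rfl⟩
  exact ⟨p, show p.length = n.toNat by omega, rfl⟩

theorem component_eq_bot {a b : V} {n : ℤ} (h : ∀ p : Quiver.Path a b, (p.length : ℤ) ≠ n) :
    Lam.component k S a b n = ⊥ := by
  rw [Lam.component, Submodule.span_eq_bot]
  rintro _ ⟨p, hp, rfl⟩
  exact absurd hp (h p)

theorem GrObj.hom_eq_zero {X Y : GrObj k S} (f : X ⟶ Y) (h : Y.deg ≤ X.deg) (hne : X ≠ Y) :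
    f = 0 := by
  refine Subtype.ext ((Submodule.mem_bot k).1 ?_)
  rw [← component_eq_bot (n := Y.deg - X.deg) (S := S) (a := X.vertex) (b := Y.vertex)]
  · exact f.2
  · intro p hp
    have h0 : p.length = 0 := by omega
    exact hne (GrObj.ext (Quiver.Path.eq_of_length_zero p h0) (by omega))

theorem GrObj.end_scalar {X : GrObj k S} (f : X ⟶ X) : ∃ c : k, f = c • 𝟙 X := by
  have h : Lam.component k S X.vertex X.vertex (X.deg - X.deg) ≤
      Submodule.span k {Lam.ofPath k S Quiver.Path.nil} := by
    refine Submodule.span_mono ?_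
    rintro _ ⟨p, hp, rfl⟩
    rw [Quiver.Path.eq_nil_of_length_zero p (by omega)]
    rfl
  obtain ⟨c, hc⟩ := Submodule.mem_span_singleton.1 (h f.2)
  exact ⟨c, Subtype.ext hc.symm⟩

/-- The underlying element of a morphism. -/
def GrObj.val (X Y : GrObj k S) : (X ⟶ Y) →ₗ[k] Lam k S X.vertex Y.vertex :=
  (Lam.component k S X.vertex Y.vertex (Y.deg - X.deg)).subtype

theorem GrObj.val_injective (X Y : GrObj k S) : Function.Injective (GrObj.val X Y) :=
  Subtype.val_injective

theorem GrObj.val_comp {X Y Z : GrObj k S} (f : X ⟶ Y) (g : Y ⟶ Z) :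
    GrObj.val X Z (f ≫ g) = Lam.mul k S _ _ _ (GrObj.val X Y f) (GrObj.val Y Z g) := rfl

/-- The morphism given by an arrow of the quiver. -/
def GrObj.ofArrow {X Y : GrObj k S} (h : X.deg + 1 = Y.deg) (γ : X.vertex ⟶ Y.vertex) : X ⟶ Y :=
  ⟨Lam.ofPath k S γ.toPath, Submodule.subset_span ⟨γ.toPath, by
    rw [Quiver.Path.length_toPath]; push_cast; omega, rfl⟩⟩

theorem GrObj.val_ofArrow {X Y : GrObj k S} (h : X.deg + 1 = Y.deg) (γ : X.vertex ⟶ Y.vertex) :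
    GrObj.val X Y (GrObj.ofArrow h γ) = Lam.ofPath k S γ.toPath := rfl

theorem GrObj.ofArrow_comp_ofArrow {X Y Z : GrObj k S} (h : X.deg + 1 = Y.deg)
    (h' : Y.deg + 1 = Z.deg) (γ : X.vertex ⟶ Y.vertex) (δ : Y.vertex ⟶ Z.vertex) (hS : S γ δ) :
    GrObj.ofArrow h γ ≫ GrObj.ofArrow h' δ = 0 := by
  apply GrObj.val_injective
  rw [GrObj.val_comp, GrObj.val_ofArrow, GrObj.val_ofArrow, Lam.mul_ofPath, map_zero]
  exact (Submodule.Quotient.mk_eq_zero _).2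
    (Submodule.subset_span ⟨_, _, _, Quiver.Path.nil, γ, δ, Quiver.Path.nil, hS, rfl⟩)

/-- The underlying element of a morphism, as an element of a representable functor. -/
def coyVal (X Y : GrObj k S) : (coy k X).obj Y →ₗ[k] Lam k S X.vertex Y.vertex := GrObj.val X Y

theorem coyVal_injective (X Y : GrObj k S) : Function.Injective (coyVal X Y) :=
  Subtype.val_injective

/-- The underlying element of a morphism of the opposite category, as an element of a
representable functor. -/
def opCoyVal (X Y : (GrObj k S)ᵒᵖ) :
    (coy k X).obj Y →ₗ[k] Lam k S Y.unop.vertex X.unop.vertex :=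
  GrObj.val Y.unop X.unop ∘ₗ (unopLinearEquiv k X Y).toLinearMap

theorem opCoyVal_injective (X Y : (GrObj k S)ᵒᵖ) : Function.Injective (opCoyVal X Y) :=
  Subtype.val_injective.comp (unopLinearEquiv k X Y).injective

theorem GrObj.finite_deg [Finite V] (n : ℤ) : {X : GrObj k S | X.deg = n}.Finite := by
  refine (Set.finite_range fun v : V => (⟨v, n⟩ : GrObj k S)).subset fun X hX => ⟨X.vertex, ?_⟩
  exact GrObj.ext rfl (Eq.symm hX)

variable (rk : ∀ {a b : V}, (a ⟶ b) → ℕ)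
  (hrk : ∀ {a b c : V} (α : a ⟶ b) (β : b ⟶ c), S α β → rk β < rk α)
  {N : ℕ} (hN : ∀ {a b : V} (α : a ⟶ b), rk α < N)
  [Finite V] [∀ a b : V, Finite (a ⟶ b)]

instance fintypeArrowsTo (b : V) : Fintype (Σ v : V, v ⟶ b) := Fintype.ofFinite _

instance fintypeArrowsFrom (a : V) : Fintype (Σ v : V, a ⟶ v) := Fintype.ofFinite _

variable (k) in
/-- The arrows of the quiver as an arrow system. -/
def arrowSystem : ArrowSystem (GrObj k S) where
  deg X := X.deg
  In Y := Σ v : V, v ⟶ Y.vertex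
  fintype _ := inferInstance
  src {Y} γ := ⟨γ.1, Y.deg - 1⟩
  arr {Y} γ := GrObj.ofArrow (by simp) γ.2
  legal γ δ := ¬ S δ.2 γ.2
  rk γ := rk γ.2
  deg_src _ := by simp
  comp_eq_zero γ δ h := GrObj.ofArrow_comp_ofArrow _ _ _ _ (not_not.1 h)
  rk_lt γ δ h := hrk δ.2 γ.2 (not_not.1 h)

variable (k) in
/-- The arrows of the quiver as an arrow system on the opposite category. -/
def opArrowSystem : ArrowSystem (GrObj k S)ᵒᵖ where
  deg X := -X.unop.deg
  In Y := Σ v : V, Y.unop.vertex ⟶ v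
  fintype _ := inferInstance
  src {Y} γ := op ⟨γ.1, Y.unop.deg + 1⟩
  arr {Y} γ := (GrObj.ofArrow (X := Y.unop) (Y := ⟨γ.1, Y.unop.deg + 1⟩) rfl γ.2).op
  legal γ δ := ¬ S γ.2 δ.2
  -- Reversing the arrows reverses the inequality between ranks; the bound `N` keeps the truncated
  -- subtraction strictly decreasing in `rk`.
  rk γ := N - rk γ.2
  deg_src _ := by simp
  comp_eq_zero {Y} γ δ h := Quiver.Hom.unop_inj (GrObj.ofArrow_comp_ofArrow (X := Y.unop)
    (Y := ⟨γ.1, Y.unop.deg + 1⟩) (Z := ⟨δ.1, Y.unop.deg + 1 + 1⟩) rfl rfl _ _ (not_not.1 h))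
  rk_lt γ δ h := by
    have h1 := hrk γ.2 δ.2 (not_not.1 h)
    have h2 := hN γ.2
    omega

theorem coyVal_act (X : GrObj k S) {Y : GrObj k S} (γ : (arrowSystem k rk hrk).In Y)
    (c : (coy k X).obj ((arrowSystem k rk hrk).src γ)) :
    coyVal X Y ((arrowSystem k rk hrk).act (coy k X) γ c) =
      Lam.mul k S X.vertex γ.1 Y.vertex (coyVal X _ c) (Lam.ofPath k S γ.2.toPath) := rfl

theorem coyVal_sum_act (X : GrObj k S) {Y : GrObj k S}
    (c : ∀ γ, (coy k X).obj ((arrowSystem k rk hrk).src (Y := Y) γ)) :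
    coyVal X Y (∑ γ, (arrowSystem k rk hrk).act (coy k X) γ (c γ)) =
      ∑ γ : (Σ v : V, v ⟶ Y.vertex),
        Lam.mul k S X.vertex γ.1 Y.vertex (coyVal X _ (c γ)) (Lam.ofPath k S γ.2.toPath) :=
  map_sum _ _ _

theorem tame_arrowSystem (X : GrObj k S) :
    Tame (arrowSystem k rk hrk) (coy k X) X.deg where
  span Y hY f := by
    replace hY : X.deg < Y.deg := hY
    have hf : coyVal X Y f ∈ Lam.component k S X.vertex Y.vertex (Y.deg - X.deg) := f.2
    obtain ⟨c, hc⟩ := exists_eq_sum_mul_arrow (m := Y.deg - 1 - X.deg) (by omega) (by ring) hf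
    exact ⟨c, coyVal_injective X Y (hc.trans (coyVal_sum_act rk hrk X c).symm)⟩
  indep Y hY c hc γ := by
    apply coyVal_injective X Y
    rw [coyVal_act, map_zero]
    replace hc := congrArg (coyVal X Y) hc
    rw [coyVal_sum_act, map_zero] at hc
    exact mul_arrow_indep (fun γ => coyVal X _ (c γ)) hc γ
  inj Y γ hY c hc h := by
    apply coyVal_injective X
    replace h := congrArg (coyVal X Y) h
    rw [coyVal_act, coyVal_sum_act, map_zero] at h
    rw [coyVal_sum_act, map_zero]
    refine mul_arrow_inj (b := γ.1) γ.2 (fun δ => coyVal X _ (c δ)) (fun δ hδ => ?_) h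
    exact (congrArg (coyVal X _) (hc δ (not_not.2 hδ))).trans (map_zero _)

theorem opCoyVal_act (X : (GrObj k S)ᵒᵖ) {Y : (GrObj k S)ᵒᵖ} (γ : (opArrowSystem k rk hrk hN).In Y)
    (c : (coy k X).obj ((opArrowSystem k rk hrk hN).src γ)) :
    opCoyVal X Y ((opArrowSystem k rk hrk hN).act (coy k X) γ c) =
      Lam.mul k S Y.unop.vertex γ.1 X.unop.vertex (Lam.ofPath k S γ.2.toPath) (opCoyVal X _ c) :=
  rfl

theorem opCoyVal_sum_act (X : (GrObj k S)ᵒᵖ) {Y : (GrObj k S)ᵒᵖ}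
    (c : ∀ γ, (coy k X).obj ((opArrowSystem k rk hrk hN).src (Y := Y) γ)) :
    opCoyVal X Y (∑ γ, (opArrowSystem k rk hrk hN).act (coy k X) γ (c γ)) =
      ∑ γ : (Σ v : V, Y.unop.vertex ⟶ v),
        Lam.mul k S Y.unop.vertex γ.1 X.unop.vertex (Lam.ofPath k S γ.2.toPath)
          (opCoyVal X _ (c γ)) :=
  map_sum _ _ _

theorem tame_opArrowSystem (X : (GrObj k S)ᵒᵖ) :
    Tame (opArrowSystem k rk hrk hN) (coy k X) (-X.unop.deg) where
  span Y hY f := by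
    replace hY : -X.unop.deg < -Y.unop.deg := hY
    have hf : opCoyVal X Y f ∈
        Lam.component k S Y.unop.vertex X.unop.vertex (X.unop.deg - Y.unop.deg) := f.unop.2
    obtain ⟨c, hc⟩ := exists_eq_sum_arrow_mul (m := X.unop.deg - (Y.unop.deg + 1)) (by omega)
      (by ring) hf
    let c' : ∀ γ, (coy k X).obj ((opArrowSystem k rk hrk hN).src (Y := Y) γ) := fun γ =>
      Quiver.Hom.op (X := (⟨γ.1, Y.unop.deg + 1⟩ : GrObj k S)) (Y := X.unop) (c γ)
    exact ⟨c', opCoyVal_injective X Y (hc.trans (opCoyVal_sum_act rk hrk hN X c').symm)⟩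
  indep Y hY c hc γ := by
    apply opCoyVal_injective X Y
    rw [opCoyVal_act, map_zero]
    replace hc := congrArg (opCoyVal X Y) hc
    rw [opCoyVal_sum_act, map_zero] at hc
    exact arrow_mul_indep (fun γ => opCoyVal X _ (c γ)) hc γ
  inj Y γ hY c hc h := by
    apply opCoyVal_injective X
    replace h := congrArg (opCoyVal X Y) h
    rw [opCoyVal_act, opCoyVal_sum_act, map_zero] at h
    rw [opCoyVal_sum_act, map_zero]
    refine arrow_mul_inj (a := γ.1) γ.2 (fun δ => opCoyVal X _ (c δ)) (fun δ hδ => ?_) h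
    exact (congrArg (opCoyVal X _) (hc δ (not_not.2 hδ))).trans (map_zero _)

theorem isMonomial_arrowSystem (hN : ∀ {a b : V} (α : a ⟶ b), rk α < N) :
    (arrowSystem k rk hrk).IsMonomial k where
  finite_deg := GrObj.finite_deg
  hom_eq_zero := GrObj.hom_eq_zero
  end_scalar := GrObj.end_scalar
  finite_hom X Y := finite_component X.vertex Y.vertex (Y.deg - X.deg)
  tame_coy := tame_arrowSystem rk hrk
  bounded_rk := ⟨N, fun _ γ => hN γ.2⟩

theorem isMonomial_opArrowSystem : (opArrowSystem k rk hrk hN).IsMonomial k where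
  finite_deg n := by
    refine ((GrObj.finite_deg (k := k) (S := S) (-n)).image op).subset fun X hX => ⟨X.unop, ?_, rfl⟩
    replace hX : -X.unop.deg = n := hX
    change X.unop.deg = -n
    omega
  hom_eq_zero {X Y} f h hne := Quiver.Hom.unop_inj (GrObj.hom_eq_zero f.unop (neg_le_neg_iff.1 h)
    fun e => hne (congrArg op e).symm)
  end_scalar f := by
    obtain ⟨c, hc⟩ := GrObj.end_scalar f.unop
    exact ⟨c, Quiver.Hom.unop_inj hc⟩
  finite_hom X Y := by
    have : Module.Finite k (Y.unop ⟶ X.unop) :=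
      finite_component Y.unop.vertex X.unop.vertex (X.unop.deg - Y.unop.deg)
    exact Module.Finite.equiv (unopLinearEquiv k X Y).symm
  tame_coy := tame_opArrowSystem rk hrk hN
  bounded_rk := ⟨N + 1, fun _ γ => Nat.lt_succ_of_le (Nat.sub_le _ _)⟩

end GradedObjects

/-! ### The rank function obtained from finite-dimensionality -/

section Rank

variable {k : Type u} [Field k] {V : Type u} [Quiver.{u} V] {R : QuadRel V}

/-- The coefficient functionals show that the avoiding paths are linearly independent in a
finite-dimensional space. -/
theorem finite_avoids (a b : V) [Module.Finite k (Lam k R a b)] :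
    Finite {p : Quiver.Path a b // Avoids R p} := by
  refine (LinearIndependent.of_pairwise_dual_eq_zero_one
    (fun p : {p : Quiver.Path a b // Avoids R p} => Lam.ofPath k R p.1) (fun p => coef k p.2)
    (fun p q h => ?_) (fun p => coef_ofPath_self p.2)).finite_of_isNoetherian (R := k)
  exact coef_ofPath_of_ne _ fun e => h (Subtype.ext e.symm)

theorem exists_length_lt [Finite V] (hfin : ∀ a b : V, Module.Finite k (Lam k R a b)) :
    ∃ N : ℕ, ∀ {a b : V} (p : Quiver.Path a b), Avoids R p → p.length < N := by
  have (a b : V) := finite_avoids (k := k) (R := R) a b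
  obtain ⟨N, hN⟩ := (Set.finite_range fun x : (Σ (a : V) (b : V),
    {p : Quiver.Path a b // Avoids R p}) => x.2.2.1.length).bddAbove
  exact ⟨N + 1, fun p hp => Nat.lt_succ_of_le (hN ⟨⟨_, _, p, hp⟩, rfl⟩)⟩

/-- The lengths of the paths `p` such that `p` followed by `β` avoids the relations. -/
def precedingLengths (R : QuadRel V) {c d : V} (β : c ⟶ d) : Set ℕ :=
  {l | ∃ (a : V) (p : Quiver.Path a c), Avoids R (p.cons β) ∧ p.length = l}

theorem precedingLengths_nonempty {c d : V} (β : c ⟶ d) : (precedingLengths R β).Nonempty :=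
  ⟨0, c, Quiver.Path.nil, avoids_toPath β, rfl⟩

theorem sSup_precedingLengths_lt {N : ℕ}
    (hN : ∀ {a b : V} (p : Quiver.Path a b), Avoids R p → p.length < N) {c d : V} (β : c ⟶ d) :
    sSup (precedingLengths R β) < N := by
  obtain ⟨a, p, hp, hl⟩ := Nat.sSup_mem (precedingLengths_nonempty β)
    ⟨N, by rintro _ ⟨a, p, hp, rfl⟩; exact (Nat.lt_of_succ_lt (hN _ hp)).le⟩
  rw [← hl]
  exact Nat.lt_of_succ_lt (hN _ hp)

/-- A longest path that can precede `α`, prolonged by `α`, can precede `β`. The supremum is attained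
because lengths are bounded. -/
theorem sSup_precedingLengths_lt_of_not_rel {N : ℕ}
    (hN : ∀ {a b : V} (p : Quiver.Path a b), Avoids R p → p.length < N) {b c d : V}
    (α : b ⟶ c) (β : c ⟶ d) (h : ¬ R α β) :
    sSup (precedingLengths R α) < sSup (precedingLengths R β) := by
  have hbdd {c d : V} (β : c ⟶ d) : BddAbove (precedingLengths R β) :=
    ⟨N, by rintro _ ⟨a, p, hp, rfl⟩; exact (Nat.lt_of_succ_lt (hN _ hp)).le⟩
  obtain ⟨a, p, hp, hl⟩ := Nat.sSup_mem (precedingLengths_nonempty α) (hbdd α)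
  rw [← hl]
  exact le_csSup (hbdd β) ⟨a, p.cons α, hp.cons_cons h, rfl⟩

theorem not_rel_of_dual {a b c : V} {α : a ⟶ b} {β : b ⟶ c}
    (h : QuadRel.dual k R β.op α.op) : ¬ R α β := fun hR =>
  h (Submodule.subset_span ⟨_, _, _, Quiver.Path.nil, α, β, Quiver.Path.nil, hR, rfl⟩)

variable (k R) in
-- An arrow is ranked by the maximal length of a path that can precede it in `Λ`. A relation of the
-- dual is a nonzero path of length two in `Λ` read backwards, so the rank drops along it.
theorem exists_rank_dual [Finite V] (hfin : ∀ a b : V, Module.Finite k (Lam k R a b)) :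
    ∃ (rk : ∀ {a b : Vᵒᵖ}, (a ⟶ b) → ℕ) (N : ℕ),
      (∀ {a b c : Vᵒᵖ} (α : a ⟶ b) (β : b ⟶ c), QuadRel.dual k R α β → rk β < rk α) ∧
      ∀ {a b : Vᵒᵖ} (α : a ⟶ b), rk α < N := by
  obtain ⟨N, hN⟩ := exists_length_lt hfin
  exact ⟨fun γ => sSup (precedingLengths R γ.unop), N,
    fun α β h => sSup_precedingLengths_lt_of_not_rel hN β.unop α.unop (not_rel_of_dual h),
    fun α => sSup_precedingLengths_lt hN α.unop⟩

end Rank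

end

end QuadMon

/-! ### The main theorem -/

open QuadMon in
theorem proposition3p7 {k : Type u} [Field k] {V : Type u} [Quiver.{u} V]
    [Finite V] [∀ a b : V, Finite (a ⟶ b)] (R : QuadRel V)
    (hfin : ∀ a b : V, Module.Finite k (Lam k R a b)) :
    IsPerfect k (QuadRel.dual k R) = IsFP k (QuadRel.dual k R) ∧
    IsCoperfect k (QuadRel.dual k R) = IsFCP k (QuadRel.dual k R) ∧
    Nonempty (Abelian (IsPerfect k (QuadRel.dual k R)).FullSubcategory) ∧
    Nonempty (Abelian (IsCoperfect k (QuadRel.dual k R)).FullSubcategory) ∧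
    AbelianWithAbelianTails k (QuadRel.dual k R) (IsFP k (QuadRel.dual k R)) ∧
    AbelianWithAbelianTails k (QuadRel.dual k R) (IsFCP k (QuadRel.dual k R)) := by
  obtain ⟨rk, N, hrk, hN⟩ := exists_rank_dual k R hfin
  have : Finite Vᵒᵖ := Finite.of_equiv V equivToOpposite
  have (a b : Vᵒᵖ) : Finite (a ⟶ b) := Finite.of_equiv (b.unop ⟶ a.unop) Quiver.Hom.opEquiv
  have hA := isMonomial_arrowSystem (k := k) rk hrk hN
  have hA' := isMonomial_opArrowSystem (k := k) rk hrk hN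
  -- The classes of graded modules are by definition the abstract ones over `GrObj`: `IsProj`
  -- unfolds to `IsFree`, and `IsInj` to `IsCofree`.
  have h₁ : IsPerfect k (QuadRel.dual k R) = IsFP k (QuadRel.dual k R) := isPerf_eq_isFinPres hA
  have h₂ : IsCoperfect k (QuadRel.dual k R) = IsFCP k (QuadRel.dual k R) :=
    isCoperf_eq_isFinCopres hA'
  have h₃ : IsFP k (QuadRel.dual k R) = IsTame k (arrowSystem k rk hrk) := isFinPres_eq_isTame hA
  have h₄ : IsFCP k (QuadRel.dual k R) = IsCotame k (opArrowSystem k rk hrk hN) :=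
    isFinCopres_eq_isCotame hA'
  have h₅ := exists_abelian_tails (k := k) (IsTame k (arrowSystem k rk hrk)) fun _ h => h.1
  have h₆ := exists_abelian_tails (k := k) (IsCotame k (opArrowSystem k rk hrk hN)) fun _ h => h.1
  refine ⟨h₁, h₂, ?_, ?_, ?_, ?_⟩
  · rw [h₁, h₃]
    exact ⟨h₅.choose⟩
  · rw [h₂, h₄]
    exact ⟨h₆.choose⟩
  · rw [h₃]
    exact ⟨isTame_of_isFinTotal, h₅⟩
  · rw [h₄]
    exact ⟨isCotame_of_isFinTotal, h₆⟩
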